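/- The model of computation is the real RAM with floor function: its registers and array cells hold real numbers, its programs use only rational constants, and each of the following costs one step: the operations $+,-,\times,\div$, comparison, $\lfloor\cdot\rfloor$, access to a register or to an array cell (at an integer address), and reporting a pair. A circle in $\mathbb{R}^3$ is given to a program by its center, its radius, and a unit normal of its plane. Write $\mathrm{dist}(p,c)=\inf\{|p-y| : y\in c\}$ for a point $p$ and a circle $c$ (a circle is a curve, not a disk). **Theorem.** There are a program and absolute constants $\alpha, c_0, K, M>0$ such that the following holds. Let $P$ be a set of $m$ points in the closed unit ball $B$ of $\mathbb{R}^3$, let $C$ be a set of $n$ circles in $\mathbb{R}^3$ of common radius $r\le 1/2$, each of which meets $B$, where $m+n\ge 1$, and let $0<\varepsilon\le c_0 r$. On input $P$, $C$, $r$, $\varepsilon$ the program halts, having reported only pairs of $P\times C$, and * every pair $(p,c)\in P\times C$ with $\mathrm{dist}(p,c)\le\varepsilon$ is reported; * every reported pair $(p,c)$ satisfies $\mathrm{dist}(p,c)\le\alpha\varepsilon$; * every pair is reported at most $M$ times; * the number of steps is at most $$K\left(\frac{m+n}{\varepsilon^{1/2}}+\frac{m^{1/3}n^{2/3}}{\varepsilon^{7/6}}+k\right),$$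 where $k$ is the number of distinct reported pairs. -/

import Mathlib

/-! Circles in Euclidean 3-space, and a real RAM with unit-cost floor function. -/

/-- Euclidean 3-space. -/
abbrev E3 : Type := EuclideanSpace ℝ (Fin 3)

/-- A circle in `ℝ³`, presented by its centre, a unit normal vector of its plane, and its radius. -/
structure Circle3 where
  center : E3
  normal : E3
  radius : ℝ
  norm_normal : ‖normal‖ = 1
  radius_pos : 0 < radius

/-- The points of the circle (a curve, not a disk). -/
def Circle3.carrier (c : Circle3) : Set E3 :=
  {x | inner ℝ (x - c.center) c.normal = 0 ∧ dist x c.center = c.radius}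

namespace RealRAM

/-- The store of a real RAM: registers that hold real numbers, random access arrays of real
numbers, and the list of the pairs that have been reported so far. A program mentions only
finitely many registers and arrays. -/
structure State where
  reg : ℕ → ℝ
  arr : ℕ → ℤ → ℝ
  out : List (ℝ × ℝ)

/-- Arithmetic expressions. The only constants are rational numbers. -/
inductive Expr where
  | const (q : ℚ)
  | reg (i : ℕ)
  | read (a : ℕ) (e : Expr)
  | add (e₁ e₂ : Expr)
  | sub (e₁ e₂ : Expr)
  | mul (e₁ e₂ : Expr)
  | div (e₁ e₂ : Expr)
  | floor (e : Expr)

namespace Expr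

/-- The value of an expression. Array addresses are rounded down to integers; division by zero
returns zero. -/
noncomputable def eval (s : State) : Expr → ℝ
  | const q => (q : ℝ)
  | reg i => s.reg i
  | read a e => s.arr a ⌊eval s e⌋
  | add e₁ e₂ => eval s e₁ + eval s e₂
  | sub e₁ e₂ => eval s e₁ - eval s e₂
  | mul e₁ e₂ => eval s e₁ * eval s e₂
  | div e₁ e₂ => eval s e₁ / eval s e₂
  | floor e => ((⌊eval s e⌋ : ℤ) : ℝ)

/-- Every constant, memory access and arithmetic operation costs one step. -/
def cost : Expr → ℕ
  | const _ => 1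
  | reg _ => 1
  | read _ e => cost e + 1
  | add e₁ e₂ => cost e₁ + cost e₂ + 1
  | sub e₁ e₂ => cost e₁ + cost e₂ + 1
  | mul e₁ e₂ => cost e₁ + cost e₂ + 1
  | div e₁ e₂ => cost e₁ + cost e₂ + 1
  | floor e => cost e + 1

end Expr

/-- Boolean combinations of comparisons. -/
inductive Test where
  | le (e₁ e₂ : Expr)
  | not (b : Test)
  | and (b₁ b₂ : Test)

namespace Test

/-- The truth value of a test. -/
def Holds (s : State) : Test → Prop
  | le e₁ e₂ => e₁.eval s ≤ e₂.eval s
  | not b => ¬ Holds s b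
  | and b₁ b₂ => Holds s b₁ ∧ Holds s b₂

/-- Every comparison and every connective costs one step. -/
def cost : Test → ℕ
  | le e₁ e₂ => e₁.cost + e₂.cost + 1
  | not b => cost b + 1
  | and b₁ b₂ => cost b₁ + cost b₂ + 1

end Test

/-- Programs: assignment to a register, writing to an array cell, reporting a pair, and the usual
control structures. -/
inductive Program where
  | skip
  | assign (i : ℕ) (e : Expr)
  | write (a : ℕ) (addr e : Expr)
  | report (e₁ e₂ : Expr)
  | seq (p₁ p₂ : Program)
  | ite (b : Test) (p₁ p₂ : Program)
  | while (b : Test) (p : Program)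

/-- Register `i` gets the value `x`. -/
def State.setReg (s : State) (i : ℕ) (x : ℝ) : State :=
  { s with reg := Function.update s.reg i x }

/-- Cell `k` of array `a` gets the value `x`. -/
def State.setArr (s : State) (a : ℕ) (k : ℤ) (x : ℝ) : State :=
  { s with arr := Function.update s.arr a (Function.update (s.arr a) k x) }

/-- The pair `(x, y)` is appended to the output. -/
def State.report (s : State) (x y : ℝ) : State :=
  { s with out := s.out ++ [(x, y)] }

/-- `Runs p s s' t`: the program `p`, started in the state `s`, halts in the state `s'` after
exactly `t` steps. Evaluating expressions and tests is charged at its cost, and every executed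
command and every test of a control structure costs one step more. -/
inductive Runs : Program → State → State → ℕ → Prop
  | skip (s : State) : Runs .skip s s 1
  | assign (s : State) (i : ℕ) (e : Expr) :
      Runs (.assign i e) s (s.setReg i (e.eval s)) (e.cost + 1)
  | write (s : State) (a : ℕ) (addr e : Expr) :
      Runs (.write a addr e) s (s.setArr a ⌊addr.eval s⌋ (e.eval s)) (addr.cost + e.cost + 1)
  | report (s : State) (e₁ e₂ : Expr) :
      Runs (.report e₁ e₂) s (s.report (e₁.eval s) (e₂.eval s)) (e₁.cost + e₂.cost + 1)
  | seq {p₁ p₂ : Program} {s s₁ s₂ : State} {t₁ t₂ : ℕ} :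
      Runs p₁ s s₁ t₁ → Runs p₂ s₁ s₂ t₂ → Runs (.seq p₁ p₂) s s₂ (t₁ + t₂)
  | ite_true {b : Test} {p₁ p₂ : Program} {s s' : State} {t : ℕ} :
      b.Holds s → Runs p₁ s s' t → Runs (.ite b p₁ p₂) s s' (b.cost + 1 + t)
  | ite_false {b : Test} {p₁ p₂ : Program} {s s' : State} {t : ℕ} :
      ¬ b.Holds s → Runs p₂ s s' t → Runs (.ite b p₁ p₂) s s' (b.cost + 1 + t)
  | while_true {b : Test} {p : Program} {s s₁ s₂ : State} {t₁ t₂ : ℕ} :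
      b.Holds s → Runs p s s₁ t₁ → Runs (.while b p) s₁ s₂ t₂ →
      Runs (.while b p) s s₂ (b.cost + 1 + t₁ + t₂)
  | while_false {b : Test} {p : Program} {s : State} :
      ¬ b.Holds s → Runs (.while b p) s s (b.cost + 1)

/-- A finite sequence of reals as the contents of an array: entries `0, …, k - 1`, then zeros. -/
def cells {k : ℕ} (v : Fin k → ℝ) (a : ℤ) : ℝ :=
  if h : 0 ≤ a ∧ a < k then v ⟨a.toNat, by omega⟩ else 0

/-- The initial state on input `m, n, r, ε`, points `p`, circles `C`: registers `0, 1, 2, 3` hold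
`m, n, r, ε`; arrays `0, 1, 2` hold the coordinates of the points, arrays `3, 4, 5` those of the
centres, and arrays `6, 7, 8` those of the unit normals. Everything else is zero, and nothing has
been reported. -/
def input {m n : ℕ} (r ε : ℝ) (p : Fin m → E3) (C : Fin n → Circle3) : State where
  reg
    | 0 => m
    | 1 => n
    | 2 => r
    | 3 => ε
    | _ => 0
  arr
    | 0 => cells fun i => p i 0
    | 1 => cells fun i => p i 1
    | 2 => cells fun i => p i 2
    | 3 => cells fun j => (C j).center 0
    | 4 => cells fun j => (C j).center 1
    | 5 => cells fun j => (C j).center 2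
    | 6 => cells fun j => (C j).normal 0
    | 7 => cells fun j => (C j).normal 1
    | 8 => cells fun j => (C j).normal 2
    | _ => fun _ => 0
  out := []

end RealRAM

/-! Put N = ⌊√(r/ε)⌋ and take integers D ≤ G with GD = N², so that r/(GD) lies between ε and 4ε.
Every circle is sampled at O(G) points with spacing O(r/G). On an arc of that length the circle
departs from the tangent at the sample by O(r/G²), hence by O(r/(GD)) = O(ε). Near a sample the
circle may thus be replaced by its tangent line.

The tangent is recorded by integers: a dominant coordinate axis, the slab of width r/G perpendicular
to it that contains the sample, the two slopes rounded to multiples of 1/D, and the two heights over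
the slab boundary rounded to multiples of r/(GD). A slope error of 1/D over O(1) slabs moves a
height by only O(r/(GD)), so the rounding is harmless. A point does not know the slopes; it tries
all O(D²) pairs of them, with O(1) offsets of slab and heights. A point within ε of a circle then
meets the key of some arc (`arc_complete`), and equality of keys forces distance O(ε)
(`Setup.infDist_le_of_key_eq`).

The digits of a key are packed injectively into one integer, which serves as an array address. Cells
start at zero and addresses are unrestricted integers, so buckets kept as linked lists join O(nG)
arcs with O(mD²) queries in time linear in these numbers and in the number of reports
(`JoinSpec.runs`). A pair is repeated only boundedly often: for a given point, the key determines
the query, and the matching arcs of one circle lie close together (`Setup.count_reports_le`). So the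
reports number O(k).

It remains to balance nG + mD². If n > Nm, take G = D = N; the total is at most 2nN, and N ≤
ε^(-1/2). If n ≤ Nm, take G = N² and D = 1; then nN² ≤ (Nm)^(1/3) n^(2/3) N² = m^(1/3) n^(2/3)
N^(7/3), and N^(7/3) ≤ ε^(-7/6) (`work_le`). -/

namespace RealRAM

/-! ### Loops, and the bucket join with linked lists -/

/-- A loop with `n` rounds halts. The invariant `I k s t` relates the number `k` of finished rounds,
the current state `s` and the time `t` spent so far. -/
theorem Runs.while_loop {b : Test} {p : Program} (I : ℕ → State → ℕ → Prop) (n : ℕ)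
    (step : ∀ k < n, ∀ s t, I k s t → b.Holds s ∧
      ∃ s' t', Runs p s s' t' ∧ I (k + 1) s' (t + (b.cost + 1 + t')))
    (last : ∀ s t, I n s t → ¬ b.Holds s) (k : ℕ) (hk : k ≤ n) (s : State) (t : ℕ)
    (h : I k s t) :
    ∃ s' t', Runs (.while b p) s s' (t' + (b.cost + 1)) ∧ I n s' (t + t') := by
  induction hk using Nat.decreasingInduction generalizing s t with
  | self => exact ⟨s, 0, by simpa using Runs.while_false (last s t h), h⟩
  | of_succ k hk ih =>
    obtain ⟨hb, s₁, t₁, h₁, hI⟩ := step k hk s t h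
    obtain ⟨s₂, t₂, h₂, hI₂⟩ := ih s₁ _ hI
    refine ⟨s₂, b.cost + 1 + t₁ + t₂, ?_, ?_⟩
    · have := Runs.while_true hb h₁ h₂
      rwa [← add_assoc] at this
    · convert hI₂ using 1
      ring

/-- `Chain next x l`: following the pointers `next` from `x` visits the successors of the entries
of `l`, and ends at `0`. -/
def Chain (next : ℤ → ℝ) : ℝ → List ℕ → Prop
  | x, [] => x = 0
  | x, e :: l => x = e + 1 ∧ Chain next (next (e + 1)) l

theorem Chain.congr {f g : ℤ → ℝ} {l : List ℕ} {x : ℝ} (h : Chain f x l)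
    (hfg : ∀ e ∈ l, f (e + 1) = g (e + 1)) : Chain g x l := by
  induction l generalizing x with
  | nil => exact h
  | cons e l ih =>
    refine ⟨h.1, ?_⟩
    rw [← hfg e (by simp)]
    exact ih h.2 fun e' he' => hfg e' (by simp [he'])

open Classical in
/-- The entries below `e` that are admissible and have key `κ`, latest first. -/
noncomputable def bucket (ok : ℕ → Prop) (key : ℕ → ℤ) (e : ℕ) (κ : ℤ) : List ℕ :=
  ((List.range e).filter fun x => ok x ∧ key x = κ).reverse

theorem mem_bucket {ok : ℕ → Prop} {key : ℕ → ℤ} {e : ℕ} {κ : ℤ} {x : ℕ} :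
    x ∈ bucket ok key e κ ↔ x < e ∧ ok x ∧ key x = κ := by
  simp [bucket]

theorem nodup_bucket (ok : ℕ → Prop) (key : ℕ → ℤ) (e : ℕ) (κ : ℤ) :
    (bucket ok key e κ).Nodup :=
  List.nodup_reverse.2 (List.nodup_range.filter _)

theorem bucket_succ_pos {ok : ℕ → Prop} {key : ℕ → ℤ} {e : ℕ} (h : ok e) :
    bucket ok key (e + 1) (key e) = e :: bucket ok key e (key e) := by
  simp [bucket, List.range_succ, h]

theorem bucket_succ_neg {ok : ℕ → Prop} {key : ℕ → ℤ} {e : ℕ} {κ : ℤ} (h : ¬ (ok e ∧ key e = κ)) :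
    bucket ok key (e + 1) κ = bucket ok key e κ := by
  simp [bucket, List.range_succ, h]

/-- `s` differs from `s₀` only in the registers and arrays that the bucket join works with. -/
def Agree (s₀ s : State) : Prop :=
  (∀ i, i ≠ 7 → i ≠ 8 → i ≠ 9 → s.reg i = s₀.reg i) ∧ ∀ a, a ≠ 9 → a ≠ 10 → s.arr a = s₀.arr a

/-- Entry number `reg 7` is put into the bucket of its key, if it is admissible. -/
def insertBody (ok : Test) (key : Expr) : Program :=
  .seq (.ite ok (.seq (.write 10 (.add (.reg 7) (.const 1)) (.read 9 key))
    (.write 9 key (.add (.reg 7) (.const 1)))) .skip) (.assign 7 (.add (.reg 7) (.const 1)))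

def insertLoop (ok : Test) (key bound : Expr) : Program :=
  .while (.not (.le bound (.reg 7))) (insertBody ok key)

/-- A bucket is traversed, and the pairs of owners are reported. -/
def walkLoop (ownP ownC : Expr) : Program :=
  .while (.not (.le (.reg 9) (.const 0)))
    (.seq (.report ownP ownC) (.assign 9 (.read 10 (.reg 9))))

def queryLoop (ownP ownC key bound : Expr) : Program :=
  .while (.not (.le bound (.reg 8)))
    (.seq (.assign 9 (.read 9 key)) (.seq (walkLoop ownP ownC)
      (.assign 8 (.add (.reg 8) (.const 1)))))

def castPair (q : ℕ × ℕ) : ℝ × ℝ := ((q.1 : ℝ), (q.2 : ℝ))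

/-- What the program's expressions have to evaluate to. -/
structure JoinSpec (s₀ : State) (E F : ℕ) (ok : ℕ → Prop) (kC kP : ℕ → ℤ) (oP oC : ℕ → ℕ)
    (okT : Test) (keyC keyP ownP ownC boundE boundF : Expr) : Prop where
  boundE : ∀ s, Agree s₀ s → boundE.eval s = E
  boundF : ∀ s, Agree s₀ s → boundF.eval s = F
  ok : ∀ s, Agree s₀ s → ∀ e < E, s.reg 7 = e → (okT.Holds s ↔ ok e)
  keyC : ∀ s, Agree s₀ s → ∀ e < E, s.reg 7 = e → keyC.eval s = kC e
  keyP : ∀ s, Agree s₀ s → ∀ f < F, s.reg 8 = f → keyP.eval s = kP f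
  ownP : ∀ s, Agree s₀ s → ∀ f < F, s.reg 8 = f → ownP.eval s = oP f
  ownC : ∀ s, Agree s₀ s → ∀ e < E, s.reg 9 = e + 1 → ownC.eval s = oC e

section

variable {s₀ : State} {E F : ℕ} {ok : ℕ → Prop} {kC kP : ℕ → ℤ} {oP oC : ℕ → ℕ}
  {okT : Test} {keyC keyP ownP ownC boundE boundF : Expr}

/-- Each round puts its entry at the head of a list, which is why buckets list the latest entry
first. Array 9 holds the heads and array 10 the successors. Pointers are shifted by one, so the
initial zeros already represent empty lists. -/
theorem JoinSpec.insert (H : JoinSpec s₀ E F ok kC kP oP oC okT keyC keyP ownP ownC boundE boundF)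
    (h7 : s₀.reg 7 = 0) (h9 : s₀.arr 9 = fun _ => 0) :
    ∃ s t, Runs (insertLoop okT keyC boundE) s₀ s t ∧
      (Agree s₀ s ∧ s.out = s₀.out ∧ s.reg 8 = s₀.reg 8 ∧
        ∀ κ, Chain (s.arr 10) (s.arr 9 κ) (bucket ok kC E κ)) ∧
      t ≤ (boundE.cost + okT.cost + 2 * keyC.cost + 20) * (E + 1) := by
  have := Runs.while_loop (b := .not (.le boundE (.reg 7))) (p := insertBody okT keyC)
    (fun e s t => s.reg 7 = e ∧ (Agree s₀ s ∧ s.out = s₀.out ∧ s.reg 8 = s₀.reg 8 ∧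
        ∀ κ, Chain (s.arr 10) (s.arr 9 κ) (bucket ok kC e κ)) ∧
      t ≤ (boundE.cost + okT.cost + 2 * keyC.cost + 20) * e) E ?_ ?_ 0 (Nat.zero_le _) s₀ 0 ?_
  · obtain ⟨s, t, hr, -, hs, ht⟩ := this
    refine ⟨s, _, hr, hs, ?_⟩
    simp only [Test.cost, Expr.cost]
    rw [zero_add] at ht
    linarith
  · rintro e he s t ⟨hs7, ⟨hA, hout, hs8, hch⟩, ht⟩
    refine ⟨?_, ?_⟩
    · simpa [Test.Holds, Expr.eval, H.boundE s hA, hs7] using he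
    have hkey := H.keyC s hA e he hs7
    by_cases hok : ok e
    · refine ⟨_, _, .seq (.ite_true ((H.ok s hA e he hs7).2 hok) (.seq (.write ..) (.write ..)))
        (.assign ..), ⟨?_, ⟨⟨?_, ?_⟩, ?_, ?_, ?_⟩, ?_⟩⟩
      · simp [State.setReg, State.setArr, Expr.eval, hs7]
      · intro i h7 h8 h9
        simp [State.setReg, State.setArr, h7, hA.1 i h7 h8 h9]
      · intro a h9 h10
        simp [State.setReg, State.setArr, h9, h10, hA.2 a h9 h10]
      · exact hout
      · simpa [State.setReg, State.setArr] using hs8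
      · intro κ
        -- The key expression is evaluated a second time after array 10 has changed; agreement
        -- ignores that array, so the value is the same.
        have hA' : Agree s₀ (s.setArr 10 ⌊(Expr.add (.reg 7) (.const 1)).eval s⌋
            ((Expr.read 9 keyC).eval s)) :=
          ⟨hA.1, fun a h9 h10 => by simp [State.setArr, h10, hA.2 a h9 h10]⟩
        have hkey' := H.keyC _ hA' e he hs7
        have hfl : ⌊(e : ℝ) + 1⌋ = (e : ℤ) + 1 := by
          rw [Int.floor_add_one, Int.floor_natCast]
        simp only [Expr.eval] at hkey'
        simp only [State.setReg, State.setArr, Expr.eval, hs7, hkey, Rat.cast_one, hfl,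
          Int.floor_intCast] at hkey' ⊢
        rw [hkey']
        simp only [Int.floor_intCast, Function.update_self,
          Function.update_of_ne (show (10 : ℕ) ≠ 9 by decide),
          Function.update_of_ne (show (9 : ℕ) ≠ 10 by decide)]
        by_cases hκ : κ = kC e
        · subst hκ
          rw [bucket_succ_pos hok, Function.update_self]
          refine ⟨rfl, ?_⟩
          rw [Function.update_self]
          -- The overwritten successor cell is `e + 1`, while the entries already in the bucket are
          -- below `e`.
          refine (hch _).congr fun e' he' => ?_
          rw [Function.update_of_ne]
          have := (mem_bucket.1 he').1
          omega
        · rw [Function.update_of_ne hκ, bucket_succ_neg (fun h => hκ h.2.symm)]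
          refine (hch _).congr fun e' he' => ?_
          rw [Function.update_of_ne]
          have := (mem_bucket.1 he').1
          omega
      · simp only [Test.cost, Expr.cost]
        linarith
    · refine ⟨_, _, .seq (.ite_false (fun h => hok ((H.ok s hA e he hs7).1 h)) (.skip _))
        (.assign ..), ⟨?_, ⟨⟨?_, ?_⟩, ?_, ?_, ?_⟩, ?_⟩⟩
      · simp [State.setReg, Expr.eval, hs7]
      · intro i h7 h8 h9
        simp [State.setReg, h7, hA.1 i h7 h8 h9]
      · exact hA.2
      · exact hout
      · simpa [State.setReg] using hs8
      · intro κ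
        rw [bucket_succ_neg (fun h => hok h.1)]
        exact hch κ
      · simp only [Test.cost, Expr.cost]
        nlinarith
  · rintro s t ⟨hs7, ⟨hA, -⟩, -⟩
    simp [Test.Holds, Expr.eval, H.boundE s hA, hs7]
  · refine ⟨by simpa using h7, ⟨⟨fun _ _ _ _ => rfl, fun _ _ _ => rfl⟩, rfl, rfl, ?_⟩, by simp⟩
    intro κ
    simp [bucket, h9, Chain]

theorem JoinSpec.walk (H : JoinSpec s₀ E F ok kC kP oP oC okT keyC keyP ownP ownC boundE boundF)
    {f : ℕ} (hf : f < F) (l : List ℕ) (hl : ∀ e ∈ l, e < E) (s : State) (hA : Agree s₀ s)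
    (hs8 : s.reg 8 = f) (hch : Chain (s.arr 10) (s.reg 9) l) :
    ∃ s' t, Runs (walkLoop ownP ownC) s s' t ∧ Agree s₀ s' ∧ s'.reg 8 = f ∧ s'.arr = s.arr ∧
      s'.out = s.out ++ (l.map fun e => castPair (oP f, oC e)) ∧
      t ≤ (ownP.cost + ownC.cost + 20) * (l.length + 1) := by
  induction l generalizing s with
  | nil =>
    refine ⟨s, _, .while_false ?_, hA, hs8, rfl, by simp, ?_⟩
    · simp only [Chain] at hch
      simp [Test.Holds, Expr.eval, hch]
    · simp [Test.cost, Expr.cost]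
  | cons e l ih =>
    obtain ⟨he9, hch⟩ := hch
    have he : e < E := hl e (by simp)
    have hP := H.ownP s hA f hf hs8
    have hC := H.ownC s hA e he he9
    have hfl : ⌊(e : ℝ) + 1⌋ = (e : ℤ) + 1 := by
      rw [Int.floor_add_one, Int.floor_natCast]
    obtain ⟨s', t, hr, hA', hs8', harr, hout, ht⟩ :=
      ih (fun e' he' => hl e' (by simp [he']))
        ((s.report (ownP.eval s) (ownC.eval s)).setReg 9
          ((Expr.read 10 (.reg 9)).eval (s.report (ownP.eval s) (ownC.eval s))))
        ⟨fun i h7 h8 h9 => by simp [State.setReg, State.report, h9, hA.1 i h7 h8 h9], hA.2⟩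
        (by simpa [State.setReg, State.report] using hs8)
        (by simpa [State.setReg, State.report, Expr.eval, he9, hfl] using hch)
    refine ⟨s', _, .while_true ?_ (.seq (.report ..) (.assign ..)) hr, hA', hs8', harr, ?_, ?_⟩
    · simp only [Test.Holds, Expr.eval, he9, Rat.cast_zero, not_le]
      positivity
    · rw [hout]
      simp [State.setReg, State.report, hP, hC, castPair]
    · simp only [Test.cost, Expr.cost, List.length_cons]
      linarith

/-- The pairs reported by the first `f` queries. -/
noncomputable def joinList (ok : ℕ → Prop) (kC kP : ℕ → ℤ) (oP oC : ℕ → ℕ) (E f : ℕ) :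
    List (ℕ × ℕ) :=
  (List.range f).flatMap fun f => (bucket ok kC E (kP f)).map fun e => (oP f, oC e)

theorem joinList_succ (ok : ℕ → Prop) (kC kP : ℕ → ℤ) (oP oC : ℕ → ℕ) (E f : ℕ) :
    joinList ok kC kP oP oC E (f + 1) = joinList ok kC kP oP oC E f ++
      (bucket ok kC E (kP f)).map fun e => (oP f, oC e) := by
  simp [joinList, List.range_succ]

/-- Each query costs a constant plus a constant for every report it makes, so the total is linear in
queries plus reports. -/
theorem JoinSpec.query (H : JoinSpec s₀ E F ok kC kP oP oC okT keyC keyP ownP ownC boundE boundF)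
    (s₁ : State) (hA : Agree s₀ s₁) (h8 : s₁.reg 8 = 0)
    (hch : ∀ κ, Chain (s₁.arr 10) (s₁.arr 9 κ) (bucket ok kC E κ)) :
    ∃ s t, Runs (queryLoop ownP ownC keyP boundF) s₁ s t ∧
      s.out = s₁.out ++ (joinList ok kC kP oP oC E F).map castPair ∧
      t ≤ (boundF.cost + keyP.cost + ownP.cost + ownC.cost + 40) *
        (F + 1 + (joinList ok kC kP oP oC E F).length) := by
  have := Runs.while_loop (b := .not (.le boundF (.reg 8)))
    (p := .seq (.assign 9 (.read 9 keyP)) (.seq (walkLoop ownP ownC)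
      (.assign 8 (.add (.reg 8) (.const 1)))))
    (fun f s t => s.reg 8 = f ∧ Agree s₀ s ∧ s.arr = s₁.arr ∧
      s.out = s₁.out ++ (joinList ok kC kP oP oC E f).map castPair ∧
      t ≤ (boundF.cost + keyP.cost + ownP.cost + ownC.cost + 40) *
        (f + (joinList ok kC kP oP oC E f).length)) F ?_ ?_ 0 (Nat.zero_le _) s₁ 0 ?_
  · obtain ⟨s, t, hr, -, -, -, hout, ht⟩ := this
    refine ⟨s, _, hr, hout, ?_⟩
    simp only [Test.cost, Expr.cost]
    rw [zero_add] at ht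
    nlinarith
  · rintro f hf s t ⟨hs8, hA, harr, hout, ht⟩
    refine ⟨?_, ?_⟩
    · simpa [Test.Holds, Expr.eval, H.boundF s hA, hs8] using hf
    have hkey := H.keyP s hA f hf hs8
    obtain ⟨s', t', hr, hA', hs8', harr', hout', ht'⟩ := H.walk hf (bucket ok kC E (kP f))
      (fun e he => (mem_bucket.1 he).1) (s.setReg 9 ((Expr.read 9 keyP).eval s))
      ⟨fun i h7 h8 h9 => by simp [State.setReg, h9, hA.1 i h7 h8 h9], hA.2⟩
      (by simpa [State.setReg] using hs8)
      (by simpa [State.setReg, Expr.eval, hkey, harr] using hch (kP f))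
    refine ⟨_, _, .seq (.assign ..) (.seq hr (.assign ..)), ?_, ⟨?_, ?_⟩, ?_, ?_, ?_⟩
    · simp [State.setReg, Expr.eval, hs8']
    · intro i h7 h8 h9
      simp [State.setReg, h8, hA'.1 i h7 h8 h9]
    · exact hA'.2
    · exact harr'.trans harr
    · rw [joinList_succ]
      simp only [State.setReg] at hout' ⊢
      rw [hout', hout]
      simp [Function.comp_def]
    · rw [joinList_succ, List.length_append, List.length_map]
      simp only [Test.cost, Expr.cost]
      have h1 : (ownP.cost + ownC.cost + 20) * ((bucket ok kC E (kP f)).length + 1) ≤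
        (boundF.cost + keyP.cost + ownP.cost + ownC.cost + 40) *
          (bucket ok kC E (kP f)).length + (ownP.cost + ownC.cost + 20) := by
        nlinarith [Nat.zero_le ((boundF.cost + keyP.cost + 20) * (bucket ok kC E (kP f)).length)]
      nlinarith
  · rintro s t ⟨hs8, hA, -⟩
    simp [Test.Holds, Expr.eval, H.boundF s hA, hs8]
  · exact ⟨by simpa using h8, hA, rfl, by simp [joinList], by simp [joinList]⟩

theorem JoinSpec.runs (H : JoinSpec s₀ E F ok kC kP oP oC okT keyC keyP ownP ownC boundE boundF)
    (h7 : s₀.reg 7 = 0) (h8 : s₀.reg 8 = 0) (h9 : s₀.arr 9 = fun _ => 0) :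
    ∃ s t, Runs (.seq (insertLoop okT keyC boundE) (queryLoop ownP ownC keyP boundF)) s₀ s t ∧
      s.out = s₀.out ++ (joinList ok kC kP oP oC E F).map castPair ∧
      t ≤ (boundE.cost + okT.cost + 2 * keyC.cost + boundF.cost + keyP.cost + ownP.cost +
        ownC.cost + 60) * (E + F + 2 + (joinList ok kC kP oP oC E F).length) := by
  obtain ⟨s₁, t₁, hr₁, ⟨hA, hout₁, hs8, hch⟩, ht₁⟩ := H.insert h7 h9
  obtain ⟨s₂, t₂, hr₂, hout₂, ht₂⟩ := H.query s₁ hA (hs8.trans h8) hch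
  refine ⟨s₂, _, .seq hr₁ hr₂, by rw [hout₂, hout₁], (Nat.add_le_add ht₁ ht₂).trans ?_⟩
  set l := (joinList ok kC kP oP oC E F).length
  have h1 : (boundE.cost + okT.cost + 2 * keyC.cost + 20) * (E + 1) ≤
    (boundE.cost + okT.cost + 2 * keyC.cost + boundF.cost + keyP.cost + ownP.cost +
        ownC.cost + 60) * (E + 1) := Nat.mul_le_mul_right _ (by omega)
  have h2 : (boundF.cost + keyP.cost + ownP.cost + ownC.cost + 40) * (F + 1 + l) ≤
    (boundE.cost + okT.cost + 2 * keyC.cost + boundF.cost + keyP.cost + ownP.cost +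
        ownC.cost + 60) * (F + 1 + l) := Nat.mul_le_mul_right _ (by omega)
  calc _ ≤ _ := Nat.add_le_add h1 h2
    _ = _ := by ring

end

end RealRAM

/-! ### Circles in orthonormal frames, and their tangents -/

/-- `u, v` is an orthonormal basis of the plane with normal `ν`. -/
structure IsFrame (ν u v : E3) : Prop where
  norm_u : ‖u‖ = 1
  norm_v : ‖v‖ = 1
  inner_uv : inner ℝ u v = 0
  inner_u : inner ℝ u ν = 0
  inner_v : inner ℝ v ν = 0
  span : ∀ x : E3, inner ℝ x ν = 0 → x = inner ℝ x u • u + inner ℝ x v • v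

theorem E3.inner_eq (x y : E3) : inner ℝ x y = x 0 * y 0 + x 1 * y 1 + x 2 * y 2 := by
  simp [PiLp.inner_apply, Fin.sum_univ_three, mul_comm]

theorem E3.norm_sq_eq (x : E3) : ‖x‖ ^ 2 = x 0 ^ 2 + x 1 ^ 2 + x 2 ^ 2 := by
  rw [EuclideanSpace.norm_sq_eq]
  simp [Fin.sum_univ_three]

/-- The images of the first two coordinate vectors under the reflection that exchanges `ν` and the
third one. -/
noncomputable def frameU (ν : E3) : E3 :=
  !₂[1 - ν 0 * ν 0 / (1 - ν 2), 0 - ν 0 * ν 1 / (1 - ν 2), ν 0]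

noncomputable def frameV (ν : E3) : E3 :=
  !₂[0 - ν 0 * ν 1 / (1 - ν 2), 1 - ν 1 * ν 1 / (1 - ν 2), ν 1]

theorem isFrame {ν : E3} (hν : ‖ν‖ = 1) : IsFrame ν (frameU ν) (frameV ν) := by
  have h1 : ν 0 ^ 2 + ν 1 ^ 2 + ν 2 ^ 2 = 1 := by rw [← E3.norm_sq_eq, hν, one_pow]
  obtain ⟨A, hA⟩ : ∃ A, A = ν 0 * ν 0 / (1 - ν 2) := ⟨_, rfl⟩
  obtain ⟨B, hB⟩ : ∃ B, B = ν 0 * ν 1 / (1 - ν 2) := ⟨_, rfl⟩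
  obtain ⟨C, hC⟩ : ∃ C, C = ν 1 * ν 1 / (1 - ν 2) := ⟨_, rfl⟩
  have key : A * A + B * B = 2 * A - ν 0 * ν 0 ∧ B * B + C * C = 2 * C - ν 1 * ν 1 ∧
      A * B + B * C = 2 * B - ν 0 * ν 1 ∧ A * ν 0 + B * ν 1 = ν 0 * (1 + ν 2) ∧
      B * ν 0 + C * ν 1 = ν 1 * (1 + ν 2) ∧ A + C = 1 + ν 2 ∨ (ν 2 = 1) := by
    by_cases h : 1 - ν 2 = 0
    · right; linarith
    · left
      have e1 : A * (1 - ν 2) = ν 0 * ν 0 := by rw [hA]; field_simp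
      have e2 : B * (1 - ν 2) = ν 0 * ν 1 := by rw [hB]; field_simp
      have e3 : C * (1 - ν 2) = ν 1 * ν 1 := by rw [hC]; field_simp
      refine ⟨?_, ?_, ?_, ?_, ?_, ?_⟩ <;> subst hA hB hC <;> field_simp <;>
        [linear_combination ν 0 ^ 2 * h1; linear_combination ν 1 ^ 2 * h1;
          linear_combination ν 0 * ν 1 * h1; linear_combination ν 0 * h1;
          linear_combination ν 1 * h1; linear_combination h1]
  have hU : frameU ν = !₂[1 - A, 0 - B, ν 0] := by rw [hA, hB]; rfl
  have hV : frameV ν = !₂[0 - B, 1 - C, ν 1] := by rw [hB, hC]; rfl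
  rcases key with ⟨k1, k2, k3, k4, k5, k6⟩ | h
  · have nU : ‖frameU ν‖ ^ 2 = 1 := by
      rw [E3.norm_sq_eq, hU]
      simp
      linear_combination k1
    have nV : ‖frameV ν‖ ^ 2 = 1 := by
      rw [E3.norm_sq_eq, hV]
      simp
      linear_combination k2
    refine ⟨?_, ?_, ?_, ?_, ?_, ?_⟩
    · nlinarith [norm_nonneg (frameU ν)]
    · nlinarith [norm_nonneg (frameV ν)]
    · rw [E3.inner_eq, hU, hV]
      simp
      linear_combination k3
    · rw [E3.inner_eq, hU]
      simp
      linear_combination -k4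
    · rw [E3.inner_eq, hV]
      simp
      linear_combination -k5
    · intro x hx
      rw [E3.inner_eq] at hx
      rw [E3.inner_eq, E3.inner_eq, hU, hV]
      ext i
      fin_cases i <;> simp
      · linear_combination (-x 0) * k1 - x 1 * k3 + x 2 * k4 + ν 0 * hx
      · linear_combination (-x 0) * k3 - x 1 * k2 + x 2 * k5 + ν 1 * hx
      · linear_combination x 0 * k4 + x 1 * k5 + ν 2 * hx - x 2 * h1
  -- Here `ν` is the third coordinate vector. Division by zero gives zero, so the formulas return
  -- the first two coordinate vectors. The machine divides by the same convention, so the program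
  -- needs no case distinction.
  · have h0 : ν 0 = 0 := by nlinarith [sq_nonneg (ν 0), sq_nonneg (ν 1)]
    have h1 : ν 1 = 0 := by nlinarith [sq_nonneg (ν 0), sq_nonneg (ν 1)]
    have hU' : frameU ν = !₂[1, 0, 0] := by simp [frameU, h0]
    have hV' : frameV ν = !₂[0, 1, 0] := by simp [frameV, h0, h1]
    rw [hU', hV']
    refine ⟨?_, ?_, ?_, ?_, ?_, ?_⟩
    · simp [EuclideanSpace.norm_eq, Fin.sum_univ_three]
    · simp [EuclideanSpace.norm_eq, Fin.sum_univ_three]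
    · simp [E3.inner_eq]
    · simp [E3.inner_eq, h0]
    · simp [E3.inner_eq, h1]
    · intro x hx
      simp [E3.inner_eq, h0, h1, h] at hx
      ext i
      fin_cases i <;> simp [E3.inner_eq, hx]

namespace IsFrame

variable {ν u v : E3}

theorem norm_sq (H : IsFrame ν u v) (a b : ℝ) : ‖a • u + b • v‖ ^ 2 = a ^ 2 + b ^ 2 := by
  rw [norm_add_sq_real, norm_smul, norm_smul, inner_smul_left, inner_smul_right, H.inner_uv,
    H.norm_u, H.norm_v]
  simp

/-- The point with coordinates `(a, b)` relative to the frame on the circle around `c`. -/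
def pt (c u v : E3) (r a b : ℝ) : E3 := c + r • (a • u + b • v)

theorem pt_sub_pt (c : E3) (r a b a' b' : ℝ) :
    pt c u v r a b - pt c u v r a' b' = (r * (a - a')) • u + (r * (b - b')) • v := by
  simp only [pt]
  module

theorem dist_sq (H : IsFrame ν u v) (c : E3) (r a b a' b' : ℝ) :
    ‖pt c u v r a b - pt c u v r a' b'‖ ^ 2 = r ^ 2 * ((a - a') ^ 2 + (b - b') ^ 2) := by
  rw [pt_sub_pt, H.norm_sq]
  ring

theorem pt_mem {c : Circle3} (H : IsFrame c.normal u v) {a b : ℝ} (hab : a ^ 2 + b ^ 2 = 1) :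
    pt c.center u v c.radius a b ∈ c.carrier := by
  have hr := c.radius_pos
  refine ⟨?_, ?_⟩
  · simp [pt, inner_smul_left, inner_add_left, H.inner_u, H.inner_v]
  · have h : ‖a • u + b • v‖ = 1 := by
      have := H.norm_sq a b
      rw [hab] at this
      nlinarith [norm_nonneg (a • u + b • v)]
    rw [dist_eq_norm, pt, add_sub_cancel_left, norm_smul, h, Real.norm_of_nonneg hr.le, mul_one]

theorem exists_pt {c : Circle3} (H : IsFrame c.normal u v) {x : E3} (hx : x ∈ c.carrier) :
    ∃ a b : ℝ, a ^ 2 + b ^ 2 = 1 ∧ x = pt c.center u v c.radius a b := by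
  have hr := c.radius_pos
  obtain ⟨h1, h2⟩ := hx
  have hs := H.span _ h1
  refine ⟨inner ℝ (x - c.center) u / c.radius, inner ℝ (x - c.center) v / c.radius, ?_, ?_⟩
  · have h3 : ‖x - c.center‖ ^ 2 = c.radius ^ 2 := by rw [← h2, dist_eq_norm]
    rw [hs, H.norm_sq] at h3
    field_simp
    exact h3
  · rw [pt, smul_add, smul_smul, smul_smul, mul_div_cancel₀ _ hr.ne', mul_div_cancel₀ _ hr.ne',
      ← hs]
    simp

/-- A circle stays close to its tangents. -/
theorem norm_sub_tangent (H : IsFrame ν u v) (c : E3) {r a b a' b' : ℝ} (hr : 0 < r)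
    (h : a ^ 2 + b ^ 2 = 1) (h' : a' ^ 2 + b' ^ 2 = 1) :
    ‖pt c u v r a b - pt c u v r a' b' - (r * (a' * b - b' * a)) • (-b' • u + a' • v)‖ =
      ‖pt c u v r a b - pt c u v r a' b'‖ ^ 2 / (2 * r) := by
  rw [H.dist_sq]
  have h1 : pt c u v r a b - pt c u v r a' b' - (r * (a' * b - b' * a)) • (-b' • u + a' • v) =
      (r * (a - a' + (a' * b - b' * a) * b')) • u +
        (r * (b - b' - (a' * b - b' * a) * a')) • v := by
    simp only [pt]
    module
  -- If θ is the angle between the two points, then after removal of the tangential part only the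
  -- radial vector of length r(1 - cos θ) is left, and this length is the squared chord over 2r.
  have h2 : r ^ 2 * ((a - a') ^ 2 + (b - b') ^ 2) / (2 * r) = r * (1 - (a * a' + b * b')) := by
    field_simp
    linear_combination h + h'
  have hcs : a * a' + b * b' ≤ 1 := by nlinarith [sq_nonneg (a - a'), sq_nonneg (b - b')]
  rw [h1, h2, ← sq_eq_sq₀ (norm_nonneg _) (mul_nonneg hr.le (by linarith)), H.norm_sq]
  have e1 : a - a' + (a' * b - b' * a) * b' = -a' * (1 - (a * a' + b * b')) := by
    linear_combination -a * h'
  have e2 : b - b' - (a' * b - b' * a) * a' = -b' * (1 - (a * a' + b * b')) := by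
    linear_combination -b * h'
  rw [e1, e2]
  linear_combination r ^ 2 * (1 - (a * a' + b * b')) ^ 2 * h'

/-- A tangent stays close to its circle. -/
theorem infDist_tangent {c : Circle3} (H : IsFrame c.normal u v) {a b : ℝ}
    (h : a ^ 2 + b ^ 2 = 1) (l : ℝ) :
    Metric.infDist (pt c.center u v c.radius a b + l • (-b • u + a • v)) c.carrier ≤
      l ^ 2 / (2 * c.radius) := by
  have hr := c.radius_pos
  set r := c.radius with hr_def
  set ρ := √(r ^ 2 + l ^ 2) with hρ
  have hρ2 : ρ ^ 2 = r ^ 2 + l ^ 2 := Real.sq_sqrt (by positivity)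
  have hρr : r ≤ ρ := Real.le_sqrt_of_sq_le (by nlinarith)
  have hρ0 : 0 < ρ := hr.trans_le hρr
  -- This is the radial projection of the tangent point to the circle. The tangent point has
  -- distance ρ = √(r² + l²) from the centre, and ρ - r ≤ l²/(2r).
  have hmem : pt c.center u v c.radius ((r * a - l * b) / ρ) ((r * b + l * a) / ρ) ∈ c.carrier := by
    refine H.pt_mem ?_
    field_simp
    rw [hρ2]
    linear_combination (r ^ 2 + l ^ 2) * h
  refine (Metric.infDist_le_dist_of_mem hmem).trans ?_
  have h1 : pt c.center u v c.radius a b + l • (-b • u + a • v) -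
      pt c.center u v c.radius ((r * a - l * b) / ρ) ((r * b + l * a) / ρ) =
      ((r * a - l * b) * (1 - r / ρ)) • u + ((r * b + l * a) * (1 - r / ρ)) • v := by
    simp only [pt, ← hr_def]
    module
  have hfr : 0 ≤ 1 - r / ρ := by rw [sub_nonneg, div_le_one hρ0]; exact hρr
  have h2 : ‖pt c.center u v c.radius a b + l • (-b • u + a • v) -
      pt c.center u v c.radius ((r * a - l * b) / ρ) ((r * b + l * a) / ρ)‖ = ρ - r := by
    rw [← sq_eq_sq₀ (norm_nonneg _) (by linarith), h1, H.norm_sq]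
    have : (ρ - r) = ρ * (1 - r / ρ) := by field_simp
    rw [this]
    linear_combination (1 - r / ρ) ^ 2 * ((r ^ 2 + l ^ 2) * h - hρ2)
  rw [dist_eq_norm, h2, le_div_iff₀ (by positivity)]
  nlinarith

end IsFrame

/-! ### Rational parametrization of the circle -/

/-- The rational parametrization of the unit circle without its leftmost point. -/
noncomputable def arcCos (t : ℝ) : ℝ := (1 - t * t) / (1 + t * t)

noncomputable def arcSin (t : ℝ) : ℝ := 2 * t / (1 + t * t)

theorem arc_sq (t : ℝ) : arcCos t ^ 2 + arcSin t ^ 2 = 1 := by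
  have : 1 + t * t ≠ 0 := by nlinarith [mul_self_nonneg t]
  simp only [arcCos, arcSin]
  field_simp
  ring

theorem arc_chord (t t' : ℝ) : (arcCos t - arcCos t') ^ 2 + (arcSin t - arcSin t') ^ 2 =
    4 * (t - t') ^ 2 / ((1 + t * t) * (1 + t' * t')) := by
  have h : 1 + t * t ≠ 0 := by nlinarith [mul_self_nonneg t]
  have h' : 1 + t' * t' ≠ 0 := by nlinarith [mul_self_nonneg t']
  simp only [arcCos, arcSin]
  field_simp
  ring

theorem arc_chord_le (t t' : ℝ) :
    (arcCos t - arcCos t') ^ 2 + (arcSin t - arcSin t') ^ 2 ≤ (2 * (t - t')) ^ 2 := by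
  rw [arc_chord]
  refine (div_le_self (by positivity) ?_).trans (by nlinarith)
  nlinarith [mul_self_nonneg t, mul_self_nonneg t', mul_nonneg (mul_self_nonneg t)
      (mul_self_nonneg t')]

/-- For parameters in [-1, 1] both denominators are at most 2, which cancels the factor 4. Chords
and parameter differences are thus comparable, without trigonometric functions. -/
theorem le_arc_chord {t t' : ℝ} (ht : |t| ≤ 1) (ht' : |t'| ≤ 1) :
    (t - t') ^ 2 ≤ (arcCos t - arcCos t') ^ 2 + (arcSin t - arcSin t') ^ 2 := by
  have h0 : 0 < 1 + t * t := by nlinarith [mul_self_nonneg t]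
  have h0' : 0 < 1 + t' * t' := by nlinarith [mul_self_nonneg t']
  rw [arc_chord, le_div_iff₀ (mul_pos h0 h0')]
  have h1 : 1 + t * t ≤ 2 := by nlinarith [abs_mul_abs_self t, abs_nonneg t]
  have h2 : 1 + t' * t' ≤ 2 := by nlinarith [abs_mul_abs_self t', abs_nonneg t']
  have h3 : (1 + t * t) * (1 + t' * t') ≤ 2 * 2 :=
    mul_le_mul h1 h2 (by nlinarith [mul_self_nonneg t']) (by norm_num)
  nlinarith [sq_nonneg (t - t')]

/-- The parameter is the tangent of the half angle, b/(1 + a). It stays in [-1, 1] on the right half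
of the circle; the left half is reached by the sign. -/
theorem exists_arc {a b : ℝ} (h : a ^ 2 + b ^ 2 = 1) :
    ∃ σ t : ℝ, (σ = 1 ∨ σ = -1) ∧ |t| ≤ 1 ∧ a = σ * arcCos t ∧ b = σ * arcSin t := by
  have main : ∀ a b : ℝ, a ^ 2 + b ^ 2 = 1 → 0 ≤ a →
      ∃ t : ℝ, |t| ≤ 1 ∧ a = arcCos t ∧ b = arcSin t := by
    intro a b h ha
    have ha1 : 1 + a ≠ 0 := by linarith
    have e : 1 + b / (1 + a) * (b / (1 + a)) = 2 / (1 + a) := by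
      field_simp
      linear_combination h
    refine ⟨b / (1 + a), ?_, ?_, ?_⟩
    · rw [abs_div, div_le_one (by positivity), abs_of_pos (by linarith : 0 < 1 + a)]
      exact abs_le_of_sq_le_sq (by nlinarith) (by linarith)
    · rw [arcCos, e]
      field_simp
      linear_combination h
    · rw [arcSin, e]
      field_simp
  rcases le_total 0 a with ha | ha
  · obtain ⟨t, ht, h1, h2⟩ := main a b h ha
    exact ⟨1, t, .inl rfl, ht, by simpa using h1, by simpa using h2⟩
  · obtain ⟨t, ht, h1, h2⟩ := main (-a) (-b) (by simpa using h) (by linarith)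
    exact ⟨-1, t, .inr rfl, ht, by linarith, by linarith⟩

/-! ### Keys of lines: dominant axis, slab, slopes, heights -/

/-- Coordinates with indices modulo 3. -/
noncomputable def coord (v : E3) (k : ℕ) : ℝ := v (Fin.ofNat 3 k)

theorem coord_sub (v w : E3) (k : ℕ) : coord (v - w) k = coord v k - coord w k := rfl

theorem coord_add (v w : E3) (k : ℕ) : coord (v + w) k = coord v k + coord w k := rfl

theorem coord_smul (a : ℝ) (v : E3) (k : ℕ) : coord (a • v) k = a * coord v k := rfl

theorem norm_sq_eq_coord (v : E3) {k : ℕ} (hk : k < 3) :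
    ‖v‖ ^ 2 = coord v k ^ 2 + coord v (k + 1) ^ 2 + coord v (k + 2) ^ 2 := by
  rw [E3.norm_sq_eq]
  interval_cases k
  · rfl
  · change _ = v 1 ^ 2 + v 2 ^ 2 + v 0 ^ 2
    ring
  · change _ = v 2 ^ 2 + v 0 ^ 2 + v 1 ^ 2
    ring

theorem abs_coord_le (v : E3) (k : ℕ) : |coord v k| ≤ ‖v‖ := by
  simpa [coord] using PiLp.norm_apply_le v (Fin.ofNat 3 k)

/-- Six bounded integers are packed into one. -/
def encode (S k i a b y z : ℤ) : ℤ := k + S * (i + S * (a + S * (b + S * (y + S * z))))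

/-- The difference of the low digits is a multiple of `S` and smaller than `S` in absolute value,
hence zero. -/
theorem eq_of_add_mul_eq {S B x x' y y' : ℤ} (hS : 2 * B < S) (hx : |x| ≤ B) (hx' : |x'| ≤ B)
    (h : x + S * y = x' + S * y') : x = x' ∧ y = y' := by
  rw [abs_le] at hx hx'
  have hS0 : 0 < S := by linarith
  have h1 : S * (y - y') = x' - x := by linear_combination h
  have h2 : y - y' = 0 := by
    have h3 : y - y' < 1 := by
      by_contra h4
      nlinarith
    have h4 : -1 < y - y' := by
      by_contra h5
      nlinarith
    omega
  refine ⟨?_, by linarith⟩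
  rw [h2] at h1
  linarith

/-- Digits are peeled off from the lowest upwards. The top digit `z` is what remains and needs no
bound. -/
theorem encode_inj {S B k i a b y z k' i' a' b' y' z' : ℤ} (hS : 2 * B < S)
    (hk : |k| ≤ B) (hi : |i| ≤ B) (ha : |a| ≤ B) (hb : |b| ≤ B) (hy : |y| ≤ B)
    (hk' : |k'| ≤ B) (hi' : |i'| ≤ B) (ha' : |a'| ≤ B) (hb' : |b'| ≤ B) (hy' : |y'| ≤ B)
    (h : encode S k i a b y z = encode S k' i' a' b' y' z') :
    k = k' ∧ i = i' ∧ a = a' ∧ b = b' ∧ y = y' ∧ z = z' := by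
  obtain ⟨h1, h⟩ := eq_of_add_mul_eq hS hk hk' h
  obtain ⟨h2, h⟩ := eq_of_add_mul_eq hS hi hi' h
  obtain ⟨h3, h⟩ := eq_of_add_mul_eq hS ha ha' h
  obtain ⟨h4, h⟩ := eq_of_add_mul_eq hS hb hb' h
  obtain ⟨h5, h⟩ := eq_of_add_mul_eq hS hy hy' h
  exact ⟨h1, h2, h3, h4, h5, h⟩

/-- The slope of direction `τ` in coordinate `l` over coordinate `k`, rounded to multiples of
`1 / D`. -/
noncomputable def slopeDigit (D : ℝ) (k l : ℕ) (τ : E3) : ℤ := ⌊D * (coord τ l / coord τ k)⌋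

/-- The height in coordinate `l`, over the boundary `i` of a slab perpendicular to coordinate `k`,
of the line through `p` with slope `a`. -/
noncomputable def height (g h : ℝ) (k l : ℕ) (i a : ℤ) (p : E3) : ℤ :=
  ⌊coord p l * h + a * (i - coord p k * g)⌋

noncomputable def slab (g : ℝ) (k : ℕ) (p : E3) : ℤ := ⌊coord p k * g⌋

noncomputable def lineKey (S : ℤ) (g h : ℝ) (k : ℕ) (i a b dy dz : ℤ) (p : E3) : ℤ :=
  encode S k i a b (height g h k (k + 1) i a p + dy) (height g h k (k + 2) i b p + dz)

/-- The key of the arc near `q` with tangent direction `τ`. -/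
noncomputable def arcKey (S : ℤ) (g h D : ℝ) (k : ℕ) (q τ : E3) : ℤ :=
  lineKey S g h k (slab g k q) (slopeDigit D k (k + 1) τ) (slopeDigit D k (k + 2) τ) 0 0 q

/-- A key of an arc that may pass near the point `p`. -/
noncomputable def pointKey (S : ℤ) (g h : ℝ) (k : ℕ) (di a b dy dz : ℤ) (p : E3) : ℤ :=
  lineKey S g h k (slab g k p + di) a b dy dz p

/-- Coordinate `k` dominates the direction `τ`. -/
def Dominant (k : ℕ) (τ : E3) : Prop :=
  coord τ (k + 1) ^ 2 ≤ coord τ k ^ 2 ∧ coord τ (k + 2) ^ 2 ≤ coord τ k ^ 2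

theorem exists_dominant (τ : E3) : ∃ k < 3, Dominant k τ := by
  have e3 : coord τ 3 = coord τ 0 := rfl
  have e4 : coord τ 4 = coord τ 1 := rfl
  rcases le_total (coord τ 1 ^ 2) (coord τ 0 ^ 2) with h | h <;>
  rcases le_total (coord τ 2 ^ 2) (coord τ 0 ^ 2) with h' | h' <;>
  rcases le_total (coord τ 1 ^ 2) (coord τ 2 ^ 2) with h'' | h''
  · exact ⟨0, by norm_num, h, h'⟩
  · exact ⟨0, by norm_num, h, h'⟩
  · exact ⟨2, by norm_num, by simpa [e3] using h', by simpa [e4] using h''⟩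
  · exact ⟨0, by norm_num, h, by linarith⟩
  · exact ⟨1, by norm_num, by simpa using (by linarith), by simpa [e3] using h⟩
  · exact ⟨1, by norm_num, by simpa using h'', by simpa [e3] using h⟩
  · exact ⟨2, by norm_num, by simpa [e3] using h', by simpa [e4] using h''⟩
  · exact ⟨1, by norm_num, by simpa using h'', by simpa [e3] using h⟩

theorem Dominant.ne_zero {k : ℕ} {τ : E3} (h : Dominant k τ) (hk : k < 3) (hτ : ‖τ‖ = 1) :
    coord τ k ≠ 0 := by
  intro h0
  have := norm_sq_eq_coord τ hk
  rw [hτ] at this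
  obtain ⟨h1, h2⟩ := h
  rw [h0] at *
  nlinarith

theorem abs_div_le_one_of_sq_le {x y : ℝ} (h : y ^ 2 ≤ x ^ 2) : |y / x| ≤ 1 := by
  rw [abs_div]
  exact div_le_one_of_le₀ (sq_le_sq.1 h) (abs_nonneg _)

theorem abs_slope_le {D : ℕ} {k l : ℕ} {τ : E3} (h : coord τ l ^ 2 ≤ coord τ k ^ 2) :
    |slopeDigit D k l τ| ≤ D := by
  have := abs_le.1 (abs_div_le_one_of_sq_le h)
  have hD : (0 : ℝ) ≤ D := Nat.cast_nonneg D
  rw [abs_le, slopeDigit]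
  refine ⟨Int.le_floor.2 ?_, ?_⟩
  · push_cast
    nlinarith
  · have : ⌊(D : ℝ) * (coord τ l / coord τ k)⌋ ≤ ⌊(D : ℝ)⌋ := Int.floor_mono (by nlinarith)
    simpa using this

theorem abs_floor_sub_floor_le {x y : ℝ} {c : ℤ} (h : |x - y| ≤ c) : |⌊x⌋ - ⌊y⌋| ≤ c := by
  rw [abs_le] at h ⊢
  have h1 : ⌊x⌋ ≤ ⌊y + c⌋ := Int.floor_mono (by linarith)
  have h2 : ⌊y⌋ ≤ ⌊x + c⌋ := Int.floor_mono (by linarith)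
  rw [Int.floor_add_intCast] at h1 h2
  omega

theorem abs_sub_lt_of_floor {x y : ℝ} {c : ℤ} (h : |⌊x⌋ - ⌊y⌋| ≤ c) : |x - y| ≤ c + 1 := by
  rw [abs_le] at h ⊢
  have h1 : (⌊x⌋ : ℝ) - ⌊y⌋ ≤ c := by exact_mod_cast h.2
  have h2 : -(c : ℝ) ≤ (⌊x⌋ : ℝ) - ⌊y⌋ := by exact_mod_cast h.1
  constructor <;> linarith [Int.floor_le x, Int.lt_floor_add_one x, Int.floor_le y,
    Int.lt_floor_add_one y]

theorem floor_slope_error (D : ℝ) (k l : ℕ) (τ : E3) :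
    |D * (coord τ l / coord τ k) - slopeDigit D k l τ| ≤ 1 := by
  rw [slopeDigit, abs_le]
  constructor <;> linarith [Int.floor_le (D * (coord τ l / coord τ k)),
    Int.lt_floor_add_one (D * (coord τ l / coord τ k))]

section

variable {g h D : ℝ} {k l : ℕ} {p q τ : E3}

/-- Up to sign, the two heights before rounding differ by the distance of `p` from the line in
coordinate `l`, at most 6 units, and by the slope error times the horizontal distance, at most 1 ·
3. This is the origin of the offset range 9. -/
theorem height_sub_height_le (hh : h = D * g) (hx : |coord p k - coord q k| * g ≤ 3)
    (hg : 0 < g) (hy : |coord p l - coord q l - coord τ l / coord τ k *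
      (coord p k - coord q k)| * h ≤ 6) (hh0 : 0 < h) (i : ℤ) :
    |height g h k l i (slopeDigit D k l τ) q - height g h k l i (slopeDigit D k l τ) p| ≤ 9 := by
  refine abs_floor_sub_floor_le ?_
  have h1 := floor_slope_error D k l τ
  set a := (slopeDigit D k l τ : ℝ)
  set m := coord τ l / coord τ k
  have e : coord q l * h + a * (i - coord q k * g) - (coord p l * h + a * (i - coord p k * g)) =
      -((coord p l - coord q l - m * (coord p k - coord q k)) * h) -
        (D * m - a) * ((coord p k - coord q k) * g) := by
    rw [hh]
    ring
  rw [e]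
  refine (abs_sub _ _).trans ?_
  rw [abs_neg, abs_mul, abs_mul, abs_mul, abs_of_pos hg, abs_of_pos hh0]
  have : |D * m - a| * (|coord p k - coord q k| * g) ≤ 1 * 3 :=
    mul_le_mul h1 hx (by positivity) (by norm_num)
  push_cast
  linarith

/-- The converse estimate: rounded heights within 9 are true heights within 10, and the rounded
slope over at most 4 slabs contributes 4 more. -/
theorem line_error_le (hh : h = D * g) (hg : 0 < g) (hx : |coord p k - coord q k| * g ≤ 4)
    (hh0 : 0 < h) (i : ℤ)
    (hy : |height g h k l i (slopeDigit D k l τ) p - height g h k l i (slopeDigit D k l τ) q| ≤ 9) :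
    |coord p l - coord q l - coord τ l / coord τ k * (coord p k - coord q k)| * h ≤ 14 := by
  have h1 := floor_slope_error D k l τ
  have h2 := abs_sub_lt_of_floor hy
  set a := (slopeDigit D k l τ : ℝ)
  set m := coord τ l / coord τ k
  have e : (coord p l - coord q l - m * (coord p k - coord q k)) * h =
      (coord p l * h + a * (i - coord p k * g) - (coord q l * h + a * (i - coord q k * g))) -
        (D * m - a) * ((coord p k - coord q k) * g) := by
    rw [hh]
    ring
  rw [← abs_of_pos hh0, ← abs_mul, e]
  refine (abs_sub _ _).trans ?_
  rw [abs_mul, abs_mul, abs_of_pos hg]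
  have : |D * m - a| * (|coord p k - coord q k| * g) ≤ 1 * 4 :=
    mul_le_mul h1 hx (by positivity) (by norm_num)
  push_cast at h2
  linarith

end

/-- The slopes are guessed exactly, and the offsets are defined as the differences between the
digits of `q` and of `p`; the point of the lemma is that they fall into the constant ranges that the
queries exhaust. -/
theorem exists_pointKey {S : ℤ} {g h : ℝ} {D k : ℕ} {p q τ : E3} (hh : h = D * g) (hg : 0 < g)
    (hh0 : 0 < h) (hx : |coord p k - coord q k| * g ≤ 3)
    (hy : |coord p (k + 1) - coord q (k + 1) - coord τ (k + 1) / coord τ k *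
      (coord p k - coord q k)| * h ≤ 6)
    (hz : |coord p (k + 2) - coord q (k + 2) - coord τ (k + 2) / coord τ k *
      (coord p k - coord q k)| * h ≤ 6) (hd : Dominant k τ) :
    ∃ di a b dy dz : ℤ, |di| ≤ 3 ∧ |a| ≤ D ∧ |b| ≤ D ∧ |dy| ≤ 9 ∧ |dz| ≤ 9 ∧
      pointKey S g h k di a b dy dz p = arcKey S g h D k q τ := by
  refine ⟨slab g k q - slab g k p, slopeDigit D k (k + 1) τ, slopeDigit D k (k + 2) τ,
    height g h k (k + 1) (slab g k q) (slopeDigit D k (k + 1) τ) q -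
      height g h k (k + 1) (slab g k q) (slopeDigit D k (k + 1) τ) p,
    height g h k (k + 2) (slab g k q) (slopeDigit D k (k + 2) τ) q -
      height g h k (k + 2) (slab g k q) (slopeDigit D k (k + 2) τ) p, ?_, abs_slope_le hd.1,
    abs_slope_le hd.2, height_sub_height_le hh hx hg hy hh0 _,
    height_sub_height_le hh hx hg hz hh0 _, ?_⟩
  · refine abs_floor_sub_floor_le ?_
    rw [← sub_mul, abs_mul, abs_of_pos hg, abs_sub_comm]
    exact_mod_cast hx
  · simp [pointKey, arcKey, lineKey]

theorem abs_floor_le_of_abs_le {x : ℝ} {c : ℝ} (h : |x| ≤ c) : ((|⌊x⌋| : ℤ) : ℝ) ≤ c + 1 := by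
  rw [abs_le] at h
  rw [Int.cast_abs, abs_le]
  constructor <;> linarith [Int.floor_le x, Int.lt_floor_add_one x]

theorem abs_height_le {g h : ℝ} {k l : ℕ} {i a : ℤ} {p : E3} {A B C : ℝ} (hh : 0 ≤ h)
    (hp : |coord p l| ≤ A) (ha : ((|a| : ℤ) : ℝ) ≤ B) (hi : |(i : ℝ) - coord p k * g| ≤ C) :
    ((|height g h k l i a p| : ℤ) : ℝ) ≤ A * h + B * C + 1 := by
  refine abs_floor_le_of_abs_le ((abs_add_le _ _).trans (add_le_add ?_ ?_))
  · rw [abs_mul, abs_of_nonneg hh]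
    exact mul_le_mul_of_nonneg_right hp hh
  · rw [abs_mul]
    rw [Int.cast_abs] at ha
    exact mul_le_mul ha hi (abs_nonneg _) ((abs_nonneg _).trans ha)

/-- The digits of the key of an arc or of a point are bounded. -/
structure SmallDigits (B : ℤ) (g h : ℝ) (k : ℕ) (i a b dy : ℤ) (p : E3) : Prop where
  axis_le : |(k : ℤ)| ≤ B
  slab_le : |i| ≤ B
  slopeY_le : |a| ≤ B
  slopeZ_le : |b| ≤ B
  height_le : |height g h k (k + 1) i a p + dy| ≤ B

theorem SmallDigits.inj {S B : ℤ} {g h : ℝ} {k k' : ℕ} {i a b dy dz i' a' b' dy' dz' : ℤ}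
    {p p' : E3} (H : SmallDigits B g h k i a b dy p) (H' : SmallDigits B g h k' i' a' b' dy' p')
    (hS : 2 * B < S)
    (he : lineKey S g h k i a b dy dz p = lineKey S g h k' i' a' b' dy' dz' p') :
    k = k' ∧ i = i' ∧ a = a' ∧ b = b' ∧
      height g h k (k + 1) i a p + dy = height g h k' (k' + 1) i' a' p' + dy' ∧
      height g h k (k + 2) i b p + dz = height g h k' (k' + 2) i' b' p' + dz' := by
  obtain ⟨h1, h2⟩ := encode_inj hS H.axis_le H.slab_le H.slopeY_le H.slopeZ_le H.height_le
    H'.axis_le H'.slab_le H'.slopeY_le H'.slopeZ_le H'.height_le he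
  exact ⟨by exact_mod_cast h1, h2⟩

/-- All lengths are measured in units in which the ball has size O(h). The height is at most 2h + 4h
+ 1 plus the offset 9, and 10 ≤ 5h because h ≥ 2; so 17h is generous. -/
theorem smallDigits {g h : ℝ} {D k : ℕ} {i a b dy : ℤ} {p : E3} {B : ℤ} (hB : 17 * h ≤ B)
    (hg0 : 0 < g) (hg : g ≤ h) (hD : D ≤ h) (hh : 2 ≤ h) (hk : k < 3) (hp : ‖p‖ ≤ 2)
    (ha : |a| ≤ D) (hb : |b| ≤ D) (hi : |slab g k p - i| ≤ 3) (hdy : |dy| ≤ 9) :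
    SmallDigits B g h k i a b dy p := by
  have hx : |coord p k * g| ≤ 2 * h := by
    rw [abs_mul, abs_of_pos hg0]
    exact mul_le_mul ((abs_coord_le p k).trans hp) hg hg0.le (by norm_num)
  have ha' : ((|a| : ℤ) : ℝ) ≤ h := le_trans (by exact_mod_cast ha) hD
  have hb' : ((|b| : ℤ) : ℝ) ≤ h := le_trans (by exact_mod_cast hb) hD
  have hi' : |(i : ℝ) - coord p k * g| ≤ 4 := by
    have : |⌊(i : ℝ)⌋ - ⌊coord p k * g⌋| ≤ 3 := by
      rw [Int.floor_intCast, abs_sub_comm]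
      exact hi
    have := abs_sub_lt_of_floor this
    push_cast at this
    linarith
  have hy := abs_height_le (k := k) (l := k + 1) (i := i) (a := a) (by linarith : 0 ≤ h)
    ((abs_coord_le p (k + 1)).trans hp) ha' hi'
  have hdy' : ((|dy| : ℤ) : ℝ) ≤ 9 := by exact_mod_cast hdy
  refine ⟨?_, ?_, ?_, ?_, ?_⟩
  · have : (k : ℝ) ≤ 2 := by exact_mod_cast Nat.le_of_lt_succ hk
    have : (k : ℝ) ≤ B := by linarith
    rw [abs_of_nonneg (by positivity)]
    exact_mod_cast this
  · have : |(i : ℝ)| ≤ 4 + 2 * h := by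
      calc |(i : ℝ)| = |((i : ℝ) - coord p k * g) + coord p k * g| := by ring_nf
        _ ≤ _ := (abs_add_le _ _).trans (add_le_add hi' hx)
    have : ((|i| : ℤ) : ℝ) ≤ B := by
      rw [Int.cast_abs]
      linarith
    exact_mod_cast this
  · have : ((|a| : ℤ) : ℝ) ≤ B := by linarith
    exact_mod_cast this
  · have : ((|b| : ℤ) : ℝ) ≤ B := by linarith
    exact_mod_cast this
  · have : ((|height g h k (k + 1) i a p + dy| : ℤ) : ℝ) ≤ B := by
      refine le_trans (Int.cast_le.2 (abs_add_le _ _)) ?_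
      push_cast at hy hdy' ⊢
      linarith
    exact_mod_cast this

/-! ### Sampled arcs: completeness and soundness of the keys -/

noncomputable def arcPt (c : Circle3) (σ t : ℝ) : E3 :=
  IsFrame.pt c.center (frameU c.normal) (frameV c.normal) c.radius (σ * arcCos t) (σ * arcSin t)

/-- The unit tangent at `arcPt c σ t`. -/
noncomputable def arcDir (c : Circle3) (σ t : ℝ) : E3 :=
  -(σ * arcSin t) • frameU c.normal + (σ * arcCos t) • frameV c.normal

theorem sign_arc_sq {σ : ℝ} (hσ : σ = 1 ∨ σ = -1) (t : ℝ) :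
    (σ * arcCos t) ^ 2 + (σ * arcSin t) ^ 2 = 1 := by
  rcases hσ with rfl | rfl <;> linarith [arc_sq t]

theorem arcPt_mem (c : Circle3) {σ : ℝ} (hσ : σ = 1 ∨ σ = -1) (t : ℝ) :
    arcPt c σ t ∈ c.carrier :=
  (isFrame c.norm_normal).pt_mem (sign_arc_sq hσ t)

theorem norm_arcDir (c : Circle3) {σ : ℝ} (hσ : σ = 1 ∨ σ = -1) (t : ℝ) : ‖arcDir c σ t‖ = 1 := by
  have := (isFrame c.norm_normal).norm_sq (-(σ * arcSin t)) (σ * arcCos t)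
  rw [neg_sq, add_comm (_ ^ 2), sign_arc_sq hσ] at this
  rw [arcDir]
  nlinarith [norm_nonneg (-(σ * arcSin t) • frameU c.normal + (σ * arcCos t) • frameV c.normal)]

theorem exists_arcPt {c : Circle3} {x : E3} (hx : x ∈ c.carrier) :
    ∃ σ t : ℝ, (σ = 1 ∨ σ = -1) ∧ |t| ≤ 1 ∧ x = arcPt c σ t := by
  obtain ⟨a, b, hab, rfl⟩ := (isFrame c.norm_normal).exists_pt hx
  obtain ⟨σ, t, hσ, ht, rfl, rfl⟩ := exists_arc hab
  exact ⟨σ, t, hσ, ht, rfl⟩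

theorem arcPt_dist_sq (c : Circle3) {σ : ℝ} (hσ : σ = 1 ∨ σ = -1) (t t' : ℝ) :
    ‖arcPt c σ t - arcPt c σ t'‖ ^ 2 =
      c.radius ^ 2 * ((arcCos t - arcCos t') ^ 2 + (arcSin t - arcSin t') ^ 2) := by
  rw [arcPt, arcPt, (isFrame c.norm_normal).dist_sq]
  rcases hσ with rfl | rfl <;> ring

theorem arcPt_dist_le (c : Circle3) {σ : ℝ} (hσ : σ = 1 ∨ σ = -1) (t t' : ℝ) :
    ‖arcPt c σ t - arcPt c σ t'‖ ≤ c.radius * (2 * |t - t'|) := by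
  have hr := c.radius_pos
  refine le_of_sq_le_sq ?_ (by positivity)
  rw [arcPt_dist_sq c hσ, mul_pow, mul_pow 2, sq_abs, ← mul_pow]
  exact mul_le_mul_of_nonneg_left (arc_chord_le t t') (by positivity)

theorem le_arcPt_dist (c : Circle3) {σ : ℝ} (hσ : σ = 1 ∨ σ = -1) {t t' : ℝ} (ht : |t| ≤ 1)
    (ht' : |t'| ≤ 1) : c.radius * |t - t'| ≤ ‖arcPt c σ t - arcPt c σ t'‖ := by
  have hr := c.radius_pos
  refine le_of_sq_le_sq ?_ (norm_nonneg _)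
  rw [arcPt_dist_sq c hσ, mul_pow, sq_abs]
  exact mul_le_mul_of_nonneg_left (le_arc_chord ht ht') (by positivity)

/-- The parameter of sample number `s`. -/
noncomputable def param (G s : ℕ) : ℝ := (s - G) / G

theorem abs_param_le {G s : ℕ} (hs : s ≤ 2 * G) : |param G s| ≤ 1 := by
  have : (s : ℝ) ≤ 2 * G := by exact_mod_cast hs
  have hs0 : (0 : ℝ) ≤ s := Nat.cast_nonneg s
  rw [param, abs_div, Nat.abs_cast]
  exact div_le_one_of_le₀ (abs_le.2 ⟨by linarith, by linarith⟩) (Nat.cast_nonneg G)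

theorem exists_param {G : ℕ} (hG : 0 < G) {t : ℝ} (ht : |t| ≤ 1) :
    ∃ s ≤ 2 * G, |t - param G s| ≤ 1 / G := by
  have hG' : (0 : ℝ) < G := by exact_mod_cast hG
  rw [abs_le] at ht
  have h0 : 0 ≤ (t + 1) * G := mul_nonneg (by linarith) hG'.le
  refine ⟨⌊(t + 1) * G⌋₊, ?_, ?_⟩
  · refine Nat.floor_le_of_le ?_
    push_cast
    nlinarith
  · have h1 := Nat.floor_le h0
    have h2 := Nat.lt_floor_add_one ((t + 1) * G)
    have : t - param G ⌊(t + 1) * G⌋₊ = ((t + 1) * G - ⌊(t + 1) * G⌋₊) / G := by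
      rw [param]
      field_simp
      ring
    rw [this, abs_div, Nat.abs_cast]
    refine div_le_div_of_nonneg_right ?_ hG'.le
    rw [abs_le]
    constructor <;> linarith

/-- The point on the line through `q` in direction `τ` with coordinate `k` that of `p`. -/
theorem coord_line_error {p q τ e : E3} {k l : ℕ} {μ : ℝ} (he : p - q = μ • τ + e)
    (h0 : coord τ k ≠ 0) :
    coord p l - coord q l - coord τ l / coord τ k * (coord p k - coord q k) =
      coord e l - coord τ l / coord τ k * coord e k := by
  have h1 : ∀ l, coord p l - coord q l = μ * coord τ l + coord e l := fun l => by
    rw [← coord_sub, he, coord_add, coord_smul]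
  rw [h1, h1]
  field_simp
  ring

/-- Go from `p` to the nearest point of the circle, from there to the nearest sample `q`, and
compare with the tangent at `q`. With ρ = r/(GD), the way from `p` to the circle costs ρ and the
bending of the arc 2r/G² ≤ 2ρ, so `p` is within 3ρ of the tangent. The distance from `p` to `q` is
at most 3r/G, which gives the slab offset 3. -/
theorem arc_complete {c : Circle3} {G D : ℕ} (hD : 0 < D) (hDG : D ≤ G) {p : E3} (S : ℤ)
    (hp : Metric.infDist p c.carrier ≤ c.radius / (G * D)) :
    ∃ σ : ℝ, (σ = 1 ∨ σ = -1) ∧ ∃ s ≤ 2 * G, ∃ k < 3, Dominant k (arcDir c σ (param G s)) ∧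
      ∃ di a b dy dz : ℤ, |di| ≤ 3 ∧ |a| ≤ D ∧ |b| ≤ D ∧ |dy| ≤ 9 ∧ |dz| ≤ 9 ∧
        pointKey S (G / c.radius) (G * D / c.radius) k di a b dy dz p =
          arcKey S (G / c.radius) (G * D / c.radius) D k (arcPt c σ (param G s))
            (arcDir c σ (param G s)) := by
  have hr := c.radius_pos
  have hG : 0 < G := hD.trans_le hDG
  have hG' : (0 : ℝ) < G := by exact_mod_cast hG
  have hD' : (0 : ℝ) < D := by exact_mod_cast hD
  have hD1 : (1 : ℝ) ≤ D := by exact_mod_cast hD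
  have hDG' : (D : ℝ) ≤ G := by exact_mod_cast hDG
  have hcl : IsClosed c.carrier := by
    have : c.carrier = {x | inner ℝ (x - c.center) c.normal = 0} ∩ {x | dist x c.center = c.radius} :=
      rfl
    rw [this]
    exact (isClosed_eq (by fun_prop) continuous_const).inter
      (isClosed_eq (by fun_prop) continuous_const)
  obtain ⟨y, hy, hpy⟩ := hcl.exists_infDist_eq_dist ⟨_, arcPt_mem c (.inl rfl) 0⟩ p
  obtain ⟨σ, t, hσ, ht, rfl⟩ := exists_arcPt hy
  obtain ⟨s, hs, hts⟩ := exists_param hG ht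
  obtain ⟨k, hk, hd⟩ := exists_dominant (arcDir c σ (param G s))
  refine ⟨σ, hσ, s, hs, k, hk, hd, ?_⟩
  set ρ := c.radius / (G * D) with hρ
  have hρ0 : 0 < ρ := by positivity
  have hρG : ρ ≤ c.radius / G := by
    refine div_le_div_of_nonneg_left hr.le hG' ?_
    nlinarith
  set q := arcPt c σ (param G s)
  set τ := arcDir c σ (param G s)
  have hτ : ‖τ‖ = 1 := norm_arcDir c hσ _
  have hyq : ‖arcPt c σ t - q‖ ≤ 2 * (c.radius / G) := by
    refine (arcPt_dist_le c hσ _ _).trans ?_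
    calc c.radius * (2 * |t - param G s|) ≤ c.radius * (2 * (1 / G)) := by gcongr
      _ = _ := by ring
  rw [hpy, dist_eq_norm] at hp
  -- The chord to the sample is at most 2r/G, so its deviation from the tangent is at most
  -- (2r/G)²/(2r) = 2r/G², and `D ≤ G` turns this into 2ρ.
  obtain ⟨μ, hμ⟩ : ∃ μ : ℝ, ‖arcPt c σ t - q - μ • τ‖ ≤ 2 * ρ := by
    refine ⟨_, ((isFrame c.norm_normal).norm_sub_tangent c.center hr (sign_arc_sq hσ t)
      (sign_arc_sq hσ (param G s))).le.trans ?_⟩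
    calc ‖arcPt c σ t - q‖ ^ 2 / (2 * c.radius) ≤ (2 * (c.radius / G)) ^ 2 / (2 * c.radius) := by
          gcongr
      _ = 2 * (c.radius / (G * G)) := by field_simp
      _ ≤ 2 * ρ := by rw [hρ]; gcongr
  have hpq : ‖p - q‖ ≤ 3 * (c.radius / G) := by
    calc ‖p - q‖ = ‖(p - arcPt c σ t) + (arcPt c σ t - q)‖ := by abel_nf
      _ ≤ _ := norm_add_le _ _
      _ ≤ _ := by linarith
  have he : ‖p - q - μ • τ‖ ≤ 3 * ρ := by
    calc ‖p - q - μ • τ‖ = ‖(p - arcPt c σ t) + (arcPt c σ t - q - μ • τ)‖ := by abel_nf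
      _ ≤ _ := norm_add_le _ _
      _ ≤ _ := by linarith
  have hdec : p - q = μ • τ + (p - q - μ • τ) := by abel
  have hline : ∀ l, coord τ l ^ 2 ≤ coord τ k ^ 2 →
      |coord p l - coord q l - coord τ l / coord τ k * (coord p k - coord q k)| *
        (G * D / c.radius) ≤ 6 := by
    intro l hl
    rw [coord_line_error hdec (hd.ne_zero hk hτ)]
    have h1 := (abs_coord_le (p - q - μ • τ) l).trans he
    have h2 := (abs_coord_le (p - q - μ • τ) k).trans he
    have h3 := abs_div_le_one_of_sq_le hl
    have h4 : |coord (p - q - μ • τ) l - coord τ l / coord τ k * coord (p - q - μ • τ) k| ≤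
        6 * ρ := by
      refine (abs_sub _ _).trans ?_
      rw [abs_mul]
      have := mul_le_mul h3 h2 (abs_nonneg _) zero_le_one
      linarith
    calc _ ≤ 6 * ρ * (G * D / c.radius) := by gcongr
      _ = 6 := by rw [hρ]; field_simp
  refine exists_pointKey (by ring) (by positivity) (by positivity) ?_ (hline _ hd.1)
    (hline _ hd.2) hd
  rw [← coord_sub]
  calc _ ≤ 3 * (c.radius / G) * (G / c.radius) := by
        gcongr
        exact (abs_coord_le _ _).trans hpq
    _ = 3 := by field_simp

/-- A point whose key is that of an arc lies close to the tangent of the arc. -/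
theorem near_tangent {c : Circle3} {G D : ℕ} (hD : 0 < D) (hDG : D ≤ G) {p q τ : E3} {k : ℕ}
    (hk : k < 3) (hd : Dominant k τ) (hτ : ‖τ‖ = 1)
    (hx : |coord p k - coord q k| * (G / c.radius) ≤ 4)
    (hy : |coord p (k + 1) - coord q (k + 1) - coord τ (k + 1) / coord τ k *
      (coord p k - coord q k)| * (G * D / c.radius) ≤ 14)
    (hz : |coord p (k + 2) - coord q (k + 2) - coord τ (k + 2) / coord τ k *
      (coord p k - coord q k)| * (G * D / c.radius) ≤ 14) :
    ∃ l : ℝ, l ^ 2 ≤ 48 * (c.radius / G) ^ 2 ∧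
      ‖p - (q + l • τ)‖ ≤ 28 * (c.radius / (G * D)) := by
  have hr := c.radius_pos
  have hG' : (0 : ℝ) < G := by exact_mod_cast hD.trans_le hDG
  have hD' : (0 : ℝ) < D := by exact_mod_cast hD
  have h0 := hd.ne_zero hk hτ
  rw [← mul_div_assoc, ← div_div_eq_mul_div, div_le_iff₀ (by positivity)] at hx hy hz
  -- The comparison point on the tangent is the one with the same dominant coordinate as `p`. The
  -- square of the dominant entry of a unit vector is at least 1/3, so l² ≤ 3δ² ≤ 3 · 16 (r/G)².
  set δ := coord p k - coord q k
  refine ⟨δ / coord τ k, ?_, ?_⟩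
  · have h1 := norm_sq_eq_coord τ hk
    rw [hτ] at h1
    obtain ⟨hd1, hd2⟩ := hd
    have h2 : (δ / coord τ k) ^ 2 ≤ 3 * δ ^ 2 := by
      rw [div_pow, div_le_iff₀ (by positivity)]
      nlinarith [sq_nonneg δ]
    have h3 : δ ^ 2 ≤ (4 * (c.radius / G)) ^ 2 := sq_le_sq' (by linarith [(abs_le.1 hx).1])
      (abs_le.1 hx).2
    nlinarith
  · set ρ := c.radius / (G * D)
    have hρ0 : 0 < ρ := by positivity
    refine le_of_sq_le_sq ?_ (by positivity)
    have e : ∀ l, coord (p - (q + (δ / coord τ k) • τ)) l =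
        coord p l - coord q l - coord τ l / coord τ k * δ := fun l => by
      rw [coord_sub, coord_add, coord_smul]
      ring
    have e0 : coord p k - coord q k - coord τ k / coord τ k * δ = 0 := by
      rw [div_self h0]
      ring
    rw [norm_sq_eq_coord _ hk, e, e, e, e0]
    have h1 := sq_le_sq' (by linarith [(abs_le.1 hy).1]) (abs_le.1 hy).2
    have h2 := sq_le_sq' (by linarith [(abs_le.1 hz).1]) (abs_le.1 hz).2
    nlinarith

/-! ### Numbering of arcs and queries in mixed radix -/

theorem Nat.add_mul_mod_of_lt {x c : ℕ} (h : x < c) (y : ℕ) : (x + c * y) % c = x := by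
  rw [Nat.add_mul_mod_self_left, Nat.mod_eq_of_lt h]

theorem Nat.add_mul_div_of_lt {x c : ℕ} (h : x < c) (y : ℕ) : (x + c * y) / c = y := by
  rw [Nat.add_mul_div_left _ _ (by omega), Nat.div_eq_of_lt h, zero_add]

theorem Nat.add_mul_lt {x c y M : ℕ} (h : x < c) (hy : y < M) : x + c * y < c * M := by
  calc x + c * y < c * (y + 1) := by rw [Nat.mul_succ]; omega
    _ ≤ c * M := Nat.mul_le_mul_left _ hy

theorem Nat.eq_of_div_eq_of_mod_eq {x y c : ℕ} (h : x / c = y / c) (h' : x % c = y % c) : x = y := by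
  rw [← Nat.div_add_mod x c, ← Nat.div_add_mod y c, h, h']

/-- An instance of the incidence problem, with resolutions `G` along the circles and `D` for the
directions of their tangents. -/
structure Setup where
  m : ℕ
  n : ℕ
  G : ℕ
  D : ℕ
  r : ℝ
  p : ℕ → E3
  C : ℕ → Circle3
  D_pos : 0 < D
  D_le : D ≤ G
  r_le : r ≤ 1 / 2
  r_pos : 0 < r
  norm_p : ∀ i < m, ‖p i‖ ≤ 1
  radius : ∀ j < n, (C j).radius = r
  meets : ∀ j < n, ((C j).carrier ∩ Metric.closedBall (0 : E3) 1).Nonempty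

namespace Setup

variable (A : Setup)

/-- The number of arcs. -/
def arcs : ℕ := 3 * (2 * ((2 * A.G + 1) * A.n))

/-- The number of queries. -/
def queries : ℕ := 3 * (7 * ((2 * A.D + 1) * ((2 * A.D + 1) * (19 * (19 * A.m)))))

def arcOwner (e : ℕ) : ℕ := e / 3 / 2 / (2 * A.G + 1)

def arcSample (e : ℕ) : ℕ := e / 3 / 2 % (2 * A.G + 1)

noncomputable def arcSign (e : ℕ) : ℝ := 1 - 2 * ((e / 3 % 2 : ℕ) : ℝ)

noncomputable def pos (e : ℕ) : E3 :=
  arcPt (A.C (A.arcOwner e)) (arcSign e) (param A.G (A.arcSample e))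

noncomputable def dir (e : ℕ) : E3 :=
  arcDir (A.C (A.arcOwner e)) (arcSign e) (param A.G (A.arcSample e))

noncomputable def g : ℝ := A.G / A.r

noncomputable def h : ℝ := A.G * A.D / A.r

/-- The lower five digits of the keys are at most ⌈17h⌉ in absolute value, and signed digits need a
base above twice that. -/
noncomputable def base : ℤ := ⌊100 * A.h⌋

def ok (e : ℕ) : Prop := Dominant (e % 3) (A.dir e)

noncomputable def kC (e : ℕ) : ℤ := arcKey A.base A.g A.h A.D (e % 3) (A.pos e) (A.dir e)

def queryOwner (f : ℕ) : ℕ := f / 3 / 7 / (2 * A.D + 1) / (2 * A.D + 1) / 19 / 19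

def queryA (f : ℕ) : ℤ := (f / 3 / 7 % (2 * A.D + 1) : ℕ) - (A.D : ℤ)

def queryB (f : ℕ) : ℤ := (f / 3 / 7 / (2 * A.D + 1) % (2 * A.D + 1) : ℕ) - (A.D : ℤ)

def queryY (f : ℕ) : ℤ := (f / 3 / 7 / (2 * A.D + 1) / (2 * A.D + 1) % 19 : ℕ) - (9 : ℤ)

def queryZ (f : ℕ) : ℤ := (f / 3 / 7 / (2 * A.D + 1) / (2 * A.D + 1) / 19 % 19 : ℕ) - (9 : ℤ)

def queryX (f : ℕ) : ℤ := (f / 3 % 7 : ℕ) - (3 : ℤ)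

noncomputable def kP (f : ℕ) : ℤ :=
  pointKey A.base A.g A.h (f % 3) (queryX f) (A.queryA f) (A.queryB f) (A.queryY f) (A.queryZ f)
    (A.p (A.queryOwner f))

variable {A}

theorem arcSign_eq (e : ℕ) : arcSign e = 1 ∨ arcSign e = -1 := by
  rcases Nat.mod_two_eq_zero_or_one (e / 3) with h | h <;> simp [arcSign, h]
  norm_num

theorem arcSample_le (e : ℕ) : A.arcSample e ≤ 2 * A.G :=
  Nat.lt_succ_iff.1 (Nat.mod_lt _ (Nat.succ_pos _))

theorem arcOwner_lt {e : ℕ} (he : e < A.arcs) : A.arcOwner e < A.n :=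
  Nat.div_lt_of_lt_mul (Nat.div_lt_of_lt_mul (Nat.div_lt_of_lt_mul he))

theorem queryOwner_lt {f : ℕ} (hf : f < A.queries) : A.queryOwner f < A.m :=
  Nat.div_lt_of_lt_mul (Nat.div_lt_of_lt_mul (Nat.div_lt_of_lt_mul (Nat.div_lt_of_lt_mul
    (Nat.div_lt_of_lt_mul (Nat.div_lt_of_lt_mul hf)))))

theorem abs_queryX_le (f : ℕ) : |queryX f| ≤ 3 := by
  rw [queryX, abs_le]
  omega

theorem abs_queryA_le (f : ℕ) : |A.queryA f| ≤ A.D := by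
  have := Nat.mod_lt (f / 3 / 7) (show 0 < 2 * A.D + 1 by omega)
  rw [queryA, abs_le]
  omega

theorem abs_queryB_le (f : ℕ) : |A.queryB f| ≤ A.D := by
  have := Nat.mod_lt (f / 3 / 7 / (2 * A.D + 1)) (show 0 < 2 * A.D + 1 by omega)
  rw [queryB, abs_le]
  omega

theorem abs_queryY_le (f : ℕ) : |A.queryY f| ≤ 9 := by
  rw [queryY, abs_le]
  omega

theorem abs_queryZ_le (f : ℕ) : |A.queryZ f| ≤ 9 := by
  rw [queryZ, abs_le]
  omega

theorem exists_arc {j s k : ℕ} {σ : ℝ} (hj : j < A.n) (hs : s ≤ 2 * A.G) (hk : k < 3)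
    (hσ : σ = 1 ∨ σ = -1) :
    ∃ e < A.arcs, A.arcOwner e = j ∧ A.arcSample e = s ∧ arcSign e = σ ∧ e % 3 = k := by
  obtain ⟨d, hd, rfl⟩ : ∃ d < 2, σ = 1 - 2 * ((d : ℕ) : ℝ) := by
    rcases hσ with rfl | rfl
    · exact ⟨0, by norm_num, by norm_num⟩
    · exact ⟨1, by norm_num, by norm_num⟩
  have hs' : s < 2 * A.G + 1 := by omega
  refine ⟨k + 3 * (d + 2 * (s + (2 * A.G + 1) * j)),
    Nat.add_mul_lt hk (Nat.add_mul_lt hd (Nat.add_mul_lt hs' hj)), ?_, ?_, ?_,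
    Nat.add_mul_mod_of_lt hk _⟩
  · rw [arcOwner, Nat.add_mul_div_of_lt hk, Nat.add_mul_div_of_lt hd, Nat.add_mul_div_of_lt hs']
  · rw [arcSample, Nat.add_mul_div_of_lt hk, Nat.add_mul_div_of_lt hd, Nat.add_mul_mod_of_lt hs']
  · rw [arcSign, Nat.add_mul_div_of_lt hk, Nat.add_mul_mod_of_lt hd]

theorem exists_query {i k : ℕ} {di a b dy dz : ℤ} (hi : i < A.m) (hk : k < 3) (hdi : |di| ≤ 3)
    (ha : |a| ≤ A.D) (hb : |b| ≤ A.D) (hy : |dy| ≤ 9) (hz : |dz| ≤ 9) :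
    ∃ f < A.queries, A.queryOwner f = i ∧ f % 3 = k ∧ queryX f = di ∧ A.queryA f = a ∧
      A.queryB f = b ∧ A.queryY f = dy ∧ A.queryZ f = dz := by
  have shift : ∀ {x : ℤ} {c : ℕ}, |x| ≤ c → ∃ d : ℕ, d < 2 * c + 1 ∧ (d : ℤ) - c = x := by
    intro x c hx
    rw [abs_le] at hx
    exact ⟨(x + c).toNat, by omega, by omega⟩
  obtain ⟨x', hx', rfl⟩ := shift (c := 3) (by exact_mod_cast hdi)
  obtain ⟨a', ha', rfl⟩ := shift ha
  obtain ⟨b', hb', rfl⟩ := shift hb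
  obtain ⟨y', hy', rfl⟩ := shift (c := 9) (by exact_mod_cast hy)
  obtain ⟨z', hz', rfl⟩ := shift (c := 9) (by exact_mod_cast hz)
  norm_num at hx' hy' hz'
  refine ⟨k + 3 * (x' + 7 * (a' + (2 * A.D + 1) * (b' + (2 * A.D + 1) *
    (y' + 19 * (z' + 19 * i))))), ?_, ?_, ?_, ?_, ?_, ?_, ?_, ?_⟩
  · exact Nat.add_mul_lt hk (Nat.add_mul_lt hx' (Nat.add_mul_lt ha' (Nat.add_mul_lt hb'
      (Nat.add_mul_lt hy' (Nat.add_mul_lt hz' hi)))))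
  · rw [queryOwner, Nat.add_mul_div_of_lt hk, Nat.add_mul_div_of_lt hx', Nat.add_mul_div_of_lt ha',
      Nat.add_mul_div_of_lt hb', Nat.add_mul_div_of_lt hy', Nat.add_mul_div_of_lt hz']
  · exact Nat.add_mul_mod_of_lt hk _
  · rw [queryX, Nat.add_mul_div_of_lt hk, Nat.add_mul_mod_of_lt hx']
    rfl
  · rw [queryA, Nat.add_mul_div_of_lt hk, Nat.add_mul_div_of_lt hx', Nat.add_mul_mod_of_lt ha']
  · rw [queryB, Nat.add_mul_div_of_lt hk, Nat.add_mul_div_of_lt hx', Nat.add_mul_div_of_lt ha',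
      Nat.add_mul_mod_of_lt hb']
  · rw [queryY, Nat.add_mul_div_of_lt hk, Nat.add_mul_div_of_lt hx', Nat.add_mul_div_of_lt ha',
      Nat.add_mul_div_of_lt hb', Nat.add_mul_mod_of_lt hy']
    rfl
  · rw [queryZ, Nat.add_mul_div_of_lt hk, Nat.add_mul_div_of_lt hx', Nat.add_mul_div_of_lt ha',
      Nat.add_mul_div_of_lt hb', Nat.add_mul_div_of_lt hy', Nat.add_mul_mod_of_lt hz']
    rfl

theorem eq_of_digits {f f' : ℕ} (h0 : A.queryOwner f = A.queryOwner f') (h1 : f % 3 = f' % 3)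
    (h2 : queryX f = queryX f') (h3 : A.queryA f = A.queryA f') (h4 : A.queryB f = A.queryB f')
    (h5 : A.queryY f = A.queryY f') (h6 : A.queryZ f = A.queryZ f') : f = f' := by
  simp only [queryX, queryA, queryB, queryY, queryZ, sub_left_inj, Nat.cast_inj] at h2 h3 h4 h5 h6
  exact Nat.eq_of_div_eq_of_mod_eq (Nat.eq_of_div_eq_of_mod_eq (Nat.eq_of_div_eq_of_mod_eq
    (Nat.eq_of_div_eq_of_mod_eq (Nat.eq_of_div_eq_of_mod_eq (Nat.eq_of_div_eq_of_mod_eq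
      h0 h6) h5) h4) h3) h2) h1

theorem G_pos : (0 : ℝ) < A.G := by exact_mod_cast A.D_pos.trans_le A.D_le

theorem one_le_D : (1 : ℝ) ≤ A.D := by exact_mod_cast A.D_pos

theorem one_le_G : (1 : ℝ) ≤ A.G := by exact_mod_cast A.D_pos.trans_le A.D_le

theorem g_pos : 0 < A.g := div_pos G_pos A.r_pos

theorem h_eq : A.h = A.D * A.g := by
  rw [h, g]
  ring

theorem g_le_h : A.g ≤ A.h := by
  rw [h_eq]
  exact le_mul_of_one_le_left g_pos.le one_le_D

theorem two_le_g : 2 ≤ A.g := by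
  rw [g, le_div_iff₀ A.r_pos]
  linarith [A.r_le, A.one_le_G]

theorem D_le_h : A.D ≤ A.h := by
  rw [h_eq]
  exact le_mul_of_one_le_right (by linarith [A.one_le_D]) (by linarith [A.two_le_g])

theorem two_ceil_lt_base : 2 * ⌈17 * A.h⌉ < A.base := by
  have h1 := Int.ceil_lt_add_one (17 * A.h)
  have h2 := Int.lt_floor_add_one (100 * A.h)
  have h3 := A.two_le_g.trans A.g_le_h
  have : ((2 * ⌈17 * A.h⌉ : ℤ) : ℝ) < (A.base : ℝ) := by
    push_cast
    rw [base]
    linarith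
  exact_mod_cast this

/-- The circle meets the unit ball and has diameter 2r ≤ 1. -/
theorem norm_pos_le {e : ℕ} (he : e < A.arcs) : ‖A.pos e‖ ≤ 2 := by
  obtain ⟨y, hy, hy1⟩ := A.meets _ (arcOwner_lt he)
  have hq : A.pos e ∈ _ := arcPt_mem (A.C (A.arcOwner e)) (arcSign_eq e) (param A.G (A.arcSample e))
  have hr := A.radius _ (arcOwner_lt he)
  have h1 : dist (A.pos e) y ≤ A.r + A.r := by
    refine (dist_triangle_right _ _ (A.C (A.arcOwner e)).center).trans ?_
    rw [hq.2, hy.2, hr]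
  rw [mem_closedBall_zero_iff] at hy1
  have h2 := norm_le_norm_add_norm_sub' (A.pos e) y
  rw [dist_eq_norm] at h1
  linarith [A.r_le]

theorem pointKey_small {f : ℕ} (hf : f < A.queries) :
    SmallDigits ⌈17 * A.h⌉ A.g A.h (f % 3) (slab A.g (f % 3) (A.p (A.queryOwner f)) + queryX f)
      (A.queryA f) (A.queryB f) (A.queryY f) (A.p (A.queryOwner f)) :=
  smallDigits (Int.le_ceil _) g_pos g_le_h D_le_h (A.two_le_g.trans g_le_h)
    (Nat.mod_lt _ (by norm_num)) ((A.norm_p _ (queryOwner_lt hf)).trans one_le_two)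
    (abs_queryA_le f) (abs_queryB_le f)
    (by rw [sub_add_cancel_left, abs_neg]; exact abs_queryX_le f) (abs_queryY_le f)

theorem arcKey_small {e : ℕ} (he : e < A.arcs) (hok : A.ok e) :
    SmallDigits ⌈17 * A.h⌉ A.g A.h (e % 3) (slab A.g (e % 3) (A.pos e))
      (slopeDigit A.D (e % 3) (e % 3 + 1) (A.dir e)) (slopeDigit A.D (e % 3) (e % 3 + 2) (A.dir e))
      0 (A.pos e) :=
  smallDigits (Int.le_ceil _) g_pos g_le_h D_le_h (A.two_le_g.trans g_le_h)
    (Nat.mod_lt _ (by norm_num)) (norm_pos_le he)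
    (abs_slope_le hok.1) (abs_slope_le hok.2) (by simp) (by simp)

/-- For a fixed point, axis and slopes are read off the key directly, the slab digit then yields the
slab offset, and once these are known the base heights are fixed, so the last two digits yield the
height offsets. -/
theorem query_inj {f f' : ℕ} (hf : f < A.queries) (hf' : f' < A.queries)
    (ho : A.queryOwner f = A.queryOwner f') (hk : A.kP f = A.kP f') : f = f' := by
  obtain ⟨h1, h2, h3, h4, h5, h6⟩ := (pointKey_small hf).inj (pointKey_small hf')
    two_ceil_lt_base hk
  rw [ho, h1] at h2
  rw [ho, h1, h2, h3] at h5
  rw [ho, h1, h2, h4] at h6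
  exact eq_of_digits ho h1 (by simpa using h2) h3 h4 (by simpa using h5) (by simpa using h6)

/-- Equal keys have equal digits, so `p` and the sample share axis and rounded slopes, their slabs
differ by at most 3 and their heights over a common boundary by at most 9. -/
theorem near {e f : ℕ} (he : e < A.arcs) (hf : f < A.queries) (hok : A.ok e)
    (hk : A.kP f = A.kC e) :
    ∃ l : ℝ, l ^ 2 ≤ 48 * (A.r / A.G) ^ 2 ∧
      ‖A.p (A.queryOwner f) - (A.pos e + l • A.dir e)‖ ≤ 28 * (A.r / (A.G * A.D)) := by
  obtain ⟨h1, h2, h3, h4, h5, h6⟩ := (pointKey_small hf).inj (arcKey_small he hok)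
    two_ceil_lt_base hk
  have hx := abs_queryX_le f
  have hy := abs_queryY_le (A := A) f
  have hz := abs_queryZ_le (A := A) f
  have h0 : 0 < A.h := by linarith [A.two_le_g, A.g_le_h]
  rw [h1] at h2
  rw [h1, h2, h3] at h5
  rw [h1, h2, h4] at h6
  have hX : |coord (A.p (A.queryOwner f)) (e % 3) - coord (A.pos e) (e % 3)| * A.g ≤ 4 := by
    have : |slab A.g (e % 3) (A.p (A.queryOwner f)) - slab A.g (e % 3) (A.pos e)| ≤ 3 := by
      rw [← h2, sub_add_cancel_left, abs_neg]
      exact hx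
    have := abs_sub_lt_of_floor this
    rw [← sub_mul, abs_mul, abs_of_pos A.g_pos] at this
    push_cast at this
    linarith
  have hY := line_error_le h_eq g_pos hX h0 (slab A.g (e % 3) (A.pos e))
    (l := e % 3 + 1) (τ := A.dir e) (by rw [abs_le] at hy ⊢; omega)
  have hZ := line_error_le h_eq g_pos hX h0 (slab A.g (e % 3) (A.pos e))
    (l := e % 3 + 2) (τ := A.dir e) (by rw [abs_le] at hz ⊢; omega)
  have hr := A.radius _ (arcOwner_lt he)
  have := near_tangent (c := A.C (A.arcOwner e)) A.D_pos A.D_le (Nat.mod_lt _ (by norm_num)) hok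
    (norm_arcDir _ (arcSign_eq e) _) (by rw [hr]; exact hX) (by rw [hr]; exact hY)
    (by rw [hr]; exact hZ)
  rwa [hr] at this

/-- The distance to the tangent contributes 28 units r/(GD); the tangent leaves the circle by
l²/(2r) ≤ 24 r/G², which is at most 24 such units since `D ≤ G`. -/
theorem infDist_le_of_key_eq {e f : ℕ} (he : e < A.arcs) (hf : f < A.queries) (hok : A.ok e)
    (hk : A.kP f = A.kC e) :
    Metric.infDist (A.p (A.queryOwner f)) (A.C (A.arcOwner e)).carrier ≤
      52 * (A.r / (A.G * A.D)) := by
  obtain ⟨l, hl, hd⟩ := near he hf hok hk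
  have hr := A.radius _ (arcOwner_lt he)
  have hr0 := A.r_pos
  have hG := A.G_pos
  have hD := A.one_le_D
  have hDG : (A.D : ℝ) ≤ A.G := by exact_mod_cast A.D_le
  have h1 := (isFrame (A.C (A.arcOwner e)).norm_normal).infDist_tangent
    (sign_arc_sq (arcSign_eq e) (param A.G (A.arcSample e))) l
  rw [hr] at h1
  have h2 : Metric.infDist (A.pos e + l • A.dir e) (A.C (A.arcOwner e)).carrier ≤
      24 * (A.r / (A.G * A.D)) := by
    rw [pos, arcPt, dir, arcDir, hr]
    refine h1.trans ?_
    calc l ^ 2 / (2 * A.r) ≤ 48 * (A.r / A.G) ^ 2 / (2 * A.r) := by gcongr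
      _ = 24 * (A.r / (A.G * A.G)) := by field_simp; norm_num
      _ ≤ _ := by gcongr
  have h3 := Metric.infDist_le_infDist_add_dist (s := (A.C (A.arcOwner e)).carrier)
    (x := A.p (A.queryOwner f)) (y := A.pos e + l • A.dir e)
  rw [dist_eq_norm] at h3
  linarith

/-- The shift along the tangent is at most 7 r/G, as 48 ≤ 7², and the distance from the tangent adds
28 r/(GD) ≤ 28 r/G. -/
theorem dist_pos_le {e f : ℕ} (he : e < A.arcs) (hf : f < A.queries) (hok : A.ok e)
    (hk : A.kP f = A.kC e) :
    ‖A.p (A.queryOwner f) - A.pos e‖ ≤ 35 * (A.r / A.G) := by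
  obtain ⟨l, hl, hd⟩ := near he hf hok hk
  have hr0 := A.r_pos
  have hG := A.G_pos
  have hτ : ‖A.dir e‖ = 1 := norm_arcDir _ (arcSign_eq e) _
  have h1 : |l| ≤ 7 * (A.r / A.G) := abs_le_of_sq_le_sq (by nlinarith [sq_nonneg (A.r / A.G)])
    (by positivity)
  have h2 : A.r / (A.G * A.D) ≤ A.r / A.G :=
    div_le_div_of_nonneg_left hr0.le hG (le_mul_of_one_le_right hG.le one_le_D)
  calc ‖A.p (A.queryOwner f) - A.pos e‖
      = ‖(A.p (A.queryOwner f) - (A.pos e + l • A.dir e)) + l • A.dir e‖ := by congr 1; abel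
    _ ≤ _ := norm_add_le _ _
    _ ≤ _ := by rw [norm_smul, hτ, Real.norm_eq_abs]; linarith

/-- Arcs of one circle that match queries for one point are close to each other. -/
theorem sample_close {e f e' f' : ℕ} (he : e < A.arcs) (hf : f < A.queries) (hok : A.ok e)
    (hk : A.kP f = A.kC e) (he' : e' < A.arcs) (hf' : f' < A.queries) (hok' : A.ok e')
    (hk' : A.kP f' = A.kC e') (hP : A.queryOwner f = A.queryOwner f')
    (hC : A.arcOwner e = A.arcOwner e') (hs : arcSign e = arcSign e') :
    |(A.arcSample e : ℤ) - A.arcSample e'| ≤ 70 := by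
  have h1 := dist_pos_le he hf hok hk
  have h2 := dist_pos_le he' hf' hok' hk'
  have hr0 := A.r_pos
  have hG := A.G_pos
  have hr := A.radius _ (arcOwner_lt he')
  have h3 : ‖A.pos e - A.pos e'‖ ≤ 70 * (A.r / A.G) := by
    calc ‖A.pos e - A.pos e'‖ = ‖(A.p (A.queryOwner f) - A.pos e') -
          (A.p (A.queryOwner f) - A.pos e)‖ := by congr 1; abel
      _ ≤ _ := norm_sub_le _ _
      _ ≤ _ := by rw [hP] at h1 ⊢; linarith
  have h4 := le_arcPt_dist (A.C (A.arcOwner e')) (arcSign_eq e')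
    (abs_param_le (arcSample_le (A := A) e)) (abs_param_le (arcSample_le (A := A) e'))
  rw [pos, pos, hC, hs] at h3
  have h5 := h4.trans h3
  have h6 : param A.G (A.arcSample e) - param A.G (A.arcSample e') =
      ((A.arcSample e : ℝ) - A.arcSample e') / A.G := by
    rw [param, param]
    ring
  rw [hr, h6, abs_div, Nat.abs_cast, mul_div_left_comm, mul_le_mul_iff_left₀ (by positivity)] at h5
  exact_mod_cast h5

theorem exists_match {i j : ℕ} (hi : i < A.m) (hj : j < A.n)
    (h : Metric.infDist (A.p i) (A.C j).carrier ≤ A.r / (A.G * A.D)) :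
    ∃ e < A.arcs, ∃ f < A.queries, A.ok e ∧ A.kP f = A.kC e ∧ A.queryOwner f = i ∧
      A.arcOwner e = j := by
  rw [← A.radius j hj] at h
  obtain ⟨σ, hσ, s, hs, k, hk, hd, di, a, b, dy, dz, h1, h2, h3, h4, h5, heq⟩ :=
    arc_complete A.D_pos A.D_le A.base h
  obtain ⟨e, he, rfl, rfl, rfl, rfl⟩ := exists_arc hj hs hk hσ
  obtain ⟨f, hf, rfl, hfk, rfl, rfl, rfl, rfl, rfl⟩ := exists_query hi hk h1 h2 h3 h4 h5
  refine ⟨e, he, f, hf, hd, ?_, rfl, rfl⟩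
  rw [A.radius _ hj] at heq
  rw [kP, hfk]
  exact heq

end Setup

/-! ### Machine expressions for the keys -/

namespace RealRAM

namespace Expr

instance : Add Expr := ⟨add⟩
instance : Sub Expr := ⟨sub⟩
instance : Mul Expr := ⟨mul⟩
instance : Div Expr := ⟨div⟩
instance (k : ℕ) : OfNat Expr k := ⟨const k⟩

section

variable (s : State) (a b : Expr)

@[simp] theorem eval_reg (i : ℕ) : (reg i).eval s = s.reg i := rfl

@[simp] theorem eval_add : (a + b).eval s = a.eval s + b.eval s := rfl

@[simp] theorem eval_sub : (a - b).eval s = a.eval s - b.eval s := rfl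

@[simp] theorem eval_mul : (a * b).eval s = a.eval s * b.eval s := rfl

@[simp] theorem eval_div : (a / b).eval s = a.eval s / b.eval s := rfl

@[simp] theorem eval_floor : (floor a).eval s = (⌊a.eval s⌋ : ℝ) := rfl

@[simp] theorem eval_ofNat (k : ℕ) : (ofNat(k) : Expr).eval s = ((OfNat.ofNat k : ℕ) : ℝ) := by
  change (((k : ℕ) : ℚ) : ℝ) = k
  exact Rat.cast_natCast k

end

/-- Quotient and remainder of the division with remainder. -/
def quot (a b : Expr) : Expr := floor (a / b)

def rem (a b : Expr) : Expr := a - b * quot a b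

section

variable {s : State} {a b : Expr} {x y : ℕ}

theorem eval_quot (ha : a.eval s = x) (hb : b.eval s = y) :
    (quot a b).eval s = ((x / y : ℕ) : ℝ) := by
  have : ⌊(x : ℝ) / y⌋ = ((x / y : ℕ) : ℤ) := by
    rw [← Nat.floor_div_eq_div (K := ℝ), Int.natCast_floor_eq_floor (by positivity)]
  rw [quot, eval_floor, eval_div, ha, hb, this, Int.cast_natCast]

theorem eval_rem (ha : a.eval s = x) (hb : b.eval s = y) :
    (rem a b).eval s = ((x % y : ℕ) : ℝ) := by
  rw [rem, eval_sub, eval_mul, eval_quot ha hb, ha, hb, sub_eq_iff_eq_add]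
  exact_mod_cast (Nat.mod_add_div x y).symm

theorem eval_read {v : ℝ} {k : ℕ} (ha : a.eval s = x) (h : s.arr k x = v) :
    (read k a).eval s = v := by
  rw [eval, ha, Int.floor_natCast, h]

end

/-- Entry number `k + l` modulo 3. -/
def select (k : Expr) (f : Fin 3 → Expr) (l : Fin 3) : Expr :=
  f l * ((k - 1) * (k - 2) / 2) + f (l + 1) * (k * (2 - k)) + f (l + 2) * (k * (k - 1) / 2)

/-- The three weights are the Lagrange polynomials of the nodes 0, 1, 2, so a coordinate with a
computed index is obtained by arithmetic alone. -/
theorem eval_select {s : State} {k : Expr} {f : Fin 3 → Expr} {x : ℕ} {v : E3}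
    (hk : k.eval s = x) (hx : x < 3) (hf : ∀ i, (f i).eval s = v i) (l : Fin 3) :
    (select k f l).eval s = coord v (x + l) := by
  simp only [select, eval_add, eval_mul, eval_sub, eval_div, eval_ofNat, hk, hf, coord]
  interval_cases x <;> fin_cases l <;> norm_num <;> rfl

def res : Expr := reg 5

def dirRes : Expr := reg 6

def gE : Expr := res / reg 2

def hE : Expr := res * dirRes / reg 2

def baseE : Expr := floor (100 * hE)

def encodeE (k i a b y z : Expr) : Expr :=
  k + baseE * (i + baseE * (a + baseE * (b + baseE * (y + baseE * z))))

def slabE (k : Expr) (p : Fin 3 → Expr) : Expr := floor (select k p 0 * gE)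

def heightE (k : Expr) (l : Fin 3) (i a : Expr) (p : Fin 3 → Expr) : Expr :=
  floor (select k p l * hE + a * (i - select k p 0 * gE))

def slopeE (k : Expr) (l : Fin 3) (d : Fin 3 → Expr) : Expr :=
  floor (dirRes * (select k d l / select k d 0))

def lineKeyE (k i a b dy dz : Expr) (p : Fin 3 → Expr) : Expr :=
  encodeE k i a b (heightE k 1 i a p + dy) (heightE k 2 i b p + dz)

def arcOwnerE (e : Expr) : Expr := quot (quot (quot e 3) 2) (2 * res + 1)

def arcAxisE (e : Expr) : Expr := rem e 3

def arcSignE (e : Expr) : Expr := 1 - 2 * rem (quot e 3) 2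

def paramE (e : Expr) : Expr := (rem (quot (quot e 3) 2) (2 * res + 1) - res) / res

def cosE (t : Expr) : Expr := (1 - t * t) / (1 + t * t)

def sinE (t : Expr) : Expr := 2 * t / (1 + t * t)

def centerE (j : Expr) (i : Fin 3) : Expr := read (3 + i) j

def normalE (j : Expr) (i : Fin 3) : Expr := read (6 + i) j

def frameUE (f : Fin 3 → Expr) : Fin 3 → Expr :=
  ![1 - f 0 * f 0 / (1 - f 2), 0 - f 0 * f 1 / (1 - f 2), f 0]

def frameVE (f : Fin 3 → Expr) : Fin 3 → Expr :=
  ![0 - f 0 * f 1 / (1 - f 2), 1 - f 1 * f 1 / (1 - f 2), f 1]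

def posE (e : Expr) (i : Fin 3) : Expr :=
  centerE (arcOwnerE e) i + reg 2 *
    (arcSignE e * cosE (paramE e) * frameUE (normalE (arcOwnerE e)) i +
      arcSignE e * sinE (paramE e) * frameVE (normalE (arcOwnerE e)) i)

def dirE (e : Expr) (i : Fin 3) : Expr :=
  (0 - arcSignE e * sinE (paramE e)) * frameUE (normalE (arcOwnerE e)) i +
    arcSignE e * cosE (paramE e) * frameVE (normalE (arcOwnerE e)) i

def arcKeyE (e : Expr) : Expr :=
  lineKeyE (arcAxisE e) (slabE (arcAxisE e) (posE e)) (slopeE (arcAxisE e) 1 (dirE e))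
    (slopeE (arcAxisE e) 2 (dirE e)) 0 0 (posE e)

def arcTest (e : Expr) : Test :=
  .and (.le (select (arcAxisE e) (dirE e) 1 * select (arcAxisE e) (dirE e) 1)
      (select (arcAxisE e) (dirE e) 0 * select (arcAxisE e) (dirE e) 0))
    (.le (select (arcAxisE e) (dirE e) 2 * select (arcAxisE e) (dirE e) 2)
      (select (arcAxisE e) (dirE e) 0 * select (arcAxisE e) (dirE e) 0))

def arcsE : Expr := 3 * (2 * ((2 * res + 1) * reg 1))

def dirCount : Expr := 2 * dirRes + 1

def queriesE : Expr := 3 * (7 * (dirCount * (dirCount * (19 * (19 * reg 0)))))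

def queryRest (f : Expr) : Expr := quot (quot f 3) 7

def queryOwnerE (f : Expr) : Expr :=
  quot (quot (quot (quot (queryRest f) dirCount) dirCount) 19) 19

def pointE (f : Expr) (i : Fin 3) : Expr := read i (queryOwnerE f)

def pointKeyE (f : Expr) : Expr :=
  lineKeyE (rem f 3) (slabE (rem f 3) (pointE f) + (rem (quot f 3) 7 - 3))
    (rem (queryRest f) dirCount - dirRes) (rem (quot (queryRest f) dirCount) dirCount - dirRes)
    (rem (quot (quot (queryRest f) dirCount) dirCount) 19 - 9)
    (rem (quot (quot (quot (queryRest f) dirCount) dirCount) 19) 19 - 9) (pointE f)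

section

variable {s : State} {x : Expr} {e : ℕ} (hx : x.eval s = e)

include hx

theorem eval_quot_three : (quot x 3).eval s = ((e / 3 : ℕ) : ℝ) :=
  eval_quot hx (by simp)

theorem eval_arcRest : (quot (quot x 3) 2).eval s = ((e / 3 / 2 : ℕ) : ℝ) :=
  eval_quot (eval_quot_three hx) (by simp)

theorem eval_arcAxisE : (arcAxisE x).eval s = (e % 3 : ℕ) :=
  eval_rem hx (by simp)

theorem eval_arcSignE : (arcSignE x).eval s = Setup.arcSign e := by
  rw [arcSignE, eval_sub, eval_mul, eval_rem (eval_quot_three hx) (y := 2) (by simp),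
    Setup.arcSign]
  simp

theorem eval_queryRest : (queryRest x).eval s = ((e / 3 / 7 : ℕ) : ℝ) :=
  eval_quot (eval_quot_three hx) (by simp)

end

end Expr

/-- The state holds the instance `A`. -/
structure Loaded (A : Setup) (s : State) : Prop where
  m : s.reg 0 = A.m
  n : s.reg 1 = A.n
  r : s.reg 2 = A.r
  G : s.reg 5 = A.G
  D : s.reg 6 = A.D
  point : ∀ i < A.m, ∀ k : Fin 3, s.arr k i = A.p i k
  center : ∀ j < A.n, ∀ k : Fin 3, s.arr (3 + k) j = (A.C j).center k
  normal : ∀ j < A.n, ∀ k : Fin 3, s.arr (6 + k) j = (A.C j).normal k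

/-- The join writes only to registers 7, 8, 9 and arrays 9, 10, which hold no part of the instance.
-/
theorem Loaded.of_agree {A : Setup} {s₀ s : State} (h : Loaded A s₀) (hA : Agree s₀ s) :
    Loaded A s := by
  refine ⟨?_, ?_, ?_, ?_, ?_, ?_, ?_, ?_⟩
  · rw [hA.1 0 (by decide) (by decide) (by decide), h.m]
  · rw [hA.1 1 (by decide) (by decide) (by decide), h.n]
  · rw [hA.1 2 (by decide) (by decide) (by decide), h.r]
  · rw [hA.1 5 (by decide) (by decide) (by decide), h.G]
  · rw [hA.1 6 (by decide) (by decide) (by decide), h.D]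
  · intro i hi k
    rw [hA.2 k (by omega) (by omega), h.point i hi k]
  · intro j hj k
    rw [hA.2 (3 + k) (by omega) (by omega), h.center j hj k]
  · intro j hj k
    rw [hA.2 (6 + k) (by omega) (by omega), h.normal j hj k]

namespace Loaded

open _root_.RealRAM.Expr

variable {A : Setup} {s : State} (h : Loaded A s)

include h

theorem eval_gE : gE.eval s = A.g := by
  simp [gE, res, h.G, h.r, Setup.g]

theorem eval_hE : hE.eval s = A.h := by
  simp [hE, res, dirRes, h.G, h.r, h.D, Setup.h]

theorem eval_baseE : baseE.eval s = A.base := by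
  rw [baseE, eval_floor, eval_mul, h.eval_hE, eval_ofNat, Setup.base]
  norm_num

section

variable {k i a b dy dz : Expr} {p : Fin 3 → Expr} {k' : ℕ} {i' a' b' dy' dz' : ℤ} {v : E3}

theorem eval_slabE (hk : k.eval s = k') (hk3 : k' < 3) (hp : ∀ i, (p i).eval s = v i) :
    (slabE k p).eval s = slab A.g k' v := by
  rw [slabE, eval_floor, eval_mul, eval_select hk hk3 hp, h.eval_gE]
  rfl

theorem eval_heightE (hk : k.eval s = k') (hk3 : k' < 3) (hp : ∀ i, (p i).eval s = v i)
    (hi : i.eval s = i') (ha : a.eval s = a') (l : Fin 3) :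
    (heightE k l i a p).eval s = height A.g A.h k' (k' + l) i' a' v := by
  simp only [heightE, eval_floor, eval_mul, eval_add, eval_sub, eval_select hk hk3 hp, h.eval_gE,
    h.eval_hE, hi, ha]
  rfl

theorem eval_slopeE (hk : k.eval s = k') (hk3 : k' < 3) (hp : ∀ i, (p i).eval s = v i)
    (l : Fin 3) : (slopeE k l p).eval s = slopeDigit A.D k' (k' + l) v := by
  simp only [slopeE, eval_floor, eval_mul, eval_div, eval_select hk hk3 hp, dirRes, eval_reg, h.D]
  rfl

theorem eval_lineKeyE (hk : k.eval s = k') (hk3 : k' < 3) (hp : ∀ i, (p i).eval s = v i)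
    (hi : i.eval s = i') (ha : a.eval s = a') (hb : b.eval s = b') (hy : dy.eval s = dy')
    (hz : dz.eval s = dz') :
    (lineKeyE k i a b dy dz p).eval s = lineKey A.base A.g A.h k' i' a' b' dy' dz' v := by
  simp only [lineKeyE, encodeE, eval_add, eval_mul, h.eval_baseE, hk, hi, ha, hb, hy, hz,
    h.eval_heightE hk hk3 hp hi ha, h.eval_heightE hk hk3 hp hi hb, lineKey, encode]
  push_cast
  rfl

end

section

variable {x : Expr} {e : ℕ} (hx : x.eval s = e)

include hx

theorem eval_arcOwnerE : (arcOwnerE x).eval s = A.arcOwner e :=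
  eval_quot (eval_arcRest hx) (by simp [res, h.G])

theorem eval_paramE : (paramE x).eval s = param A.G (A.arcSample e) := by
  rw [paramE, eval_div, eval_sub,
    eval_rem (eval_arcRest hx) (y := 2 * A.G + 1) (by simp [res, h.G])]
  simp only [res, eval_reg, h.G]
  rfl

theorem eval_cosE : (cosE (paramE x)).eval s = arcCos (param A.G (A.arcSample e)) := by
  simp [cosE, h.eval_paramE hx, arcCos]

theorem eval_sinE : (sinE (paramE x)).eval s = arcSin (param A.G (A.arcSample e)) := by
  simp [sinE, h.eval_paramE hx, arcSin]

variable (he : e < A.arcs)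

include he

theorem eval_centerE (i : Fin 3) :
    (centerE (arcOwnerE x) i).eval s = (A.C (A.arcOwner e)).center i :=
  eval_read (h.eval_arcOwnerE hx) (h.center _ (Setup.arcOwner_lt he) i)

theorem eval_normalE (i : Fin 3) :
    (normalE (arcOwnerE x) i).eval s = (A.C (A.arcOwner e)).normal i :=
  eval_read (h.eval_arcOwnerE hx) (h.normal _ (Setup.arcOwner_lt he) i)

theorem eval_frameUE (i : Fin 3) :
    (frameUE (normalE (arcOwnerE x)) i).eval s = frameU (A.C (A.arcOwner e)).normal i := by
  fin_cases i <;> simp [frameUE, frameU, h.eval_normalE hx he]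

theorem eval_frameVE (i : Fin 3) :
    (frameVE (normalE (arcOwnerE x)) i).eval s = frameV (A.C (A.arcOwner e)).normal i := by
  fin_cases i <;> simp [frameVE, frameV, h.eval_normalE hx he]

theorem eval_posE (i : Fin 3) : (posE x i).eval s = A.pos e i := by
  simp only [posE, eval_add, eval_mul, eval_reg, h.r, h.eval_centerE hx he, eval_arcSignE hx,
    h.eval_cosE hx, h.eval_sinE hx, h.eval_frameUE hx he, h.eval_frameVE hx he, Setup.pos, arcPt,
    IsFrame.pt, A.radius _ (Setup.arcOwner_lt he), PiLp.add_apply, PiLp.smul_apply, smul_eq_mul]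

theorem eval_dirE (i : Fin 3) : (dirE x i).eval s = A.dir e i := by
  simp [dirE, eval_arcSignE hx, h.eval_cosE hx, h.eval_sinE hx, h.eval_frameUE hx he,
    h.eval_frameVE hx he, Setup.dir, arcDir]

theorem eval_arcKeyE : (arcKeyE x).eval s = A.kC e := by
  have h3 : e % 3 < 3 := Nat.mod_lt _ (by norm_num)
  have hk := eval_arcAxisE hx
  exact h.eval_lineKeyE hk h3 (h.eval_posE hx he) (h.eval_slabE hk h3 (h.eval_posE hx he))
    (h.eval_slopeE hk h3 (h.eval_dirE hx he) 1) (h.eval_slopeE hk h3 (h.eval_dirE hx he) 2)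
    (by simp) (by simp)

theorem holds_arcTest : (arcTest x).Holds s ↔ A.ok e := by
  have h3 : e % 3 < 3 := Nat.mod_lt _ (by norm_num)
  have hk := eval_arcAxisE hx
  simp only [arcTest, Test.Holds, eval_mul, eval_select hk h3 (h.eval_dirE hx he), ← pow_two]
  rfl

end

section

variable {x : Expr} {f : ℕ} (hx : x.eval s = f)

theorem eval_dirCount : dirCount.eval s = (2 * A.D + 1 : ℕ) := by
  simp [dirCount, dirRes, h.D]

include hx

theorem eval_queryRest₁ :
    (quot (queryRest x) dirCount).eval s = ((f / 3 / 7 / (2 * A.D + 1) : ℕ) : ℝ) :=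
  eval_quot (eval_queryRest hx) h.eval_dirCount

theorem eval_queryRest₂ : (quot (quot (queryRest x) dirCount) dirCount).eval s =
    ((f / 3 / 7 / (2 * A.D + 1) / (2 * A.D + 1) : ℕ) : ℝ) :=
  eval_quot (h.eval_queryRest₁ hx) h.eval_dirCount

theorem eval_queryRest₃ : (quot (quot (quot (queryRest x) dirCount) dirCount) 19).eval s =
    ((f / 3 / 7 / (2 * A.D + 1) / (2 * A.D + 1) / 19 : ℕ) : ℝ) :=
  eval_quot (h.eval_queryRest₂ hx) (by simp)

theorem eval_queryOwnerE : (queryOwnerE x).eval s = A.queryOwner f :=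
  eval_quot (h.eval_queryRest₃ hx) (by simp)

theorem eval_pointKeyE (hf : f < A.queries) : (pointKeyE x).eval s = A.kP f := by
  have h3 : f % 3 < 3 := Nat.mod_lt _ (by norm_num)
  have hk : (rem x 3).eval s = (f % 3 : ℕ) := eval_rem hx (by simp)
  have hp : ∀ i, (pointE x i).eval s = A.p (A.queryOwner f) i := fun i =>
    eval_read (h.eval_queryOwnerE hx) (h.point _ (Setup.queryOwner_lt hf) i)
  refine h.eval_lineKeyE hk h3 hp ?_ ?_ ?_ ?_ ?_
  · rw [eval_add, h.eval_slabE hk h3 hp, eval_sub,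
      eval_rem (eval_quot_three hx) (y := 7) (by simp), Setup.queryX]
    simp only [Int.cast_sub, Int.cast_add, Int.cast_natCast, Int.cast_ofNat, eval_ofNat,
      Nat.cast_ofNat]
  · rw [eval_sub, eval_rem (eval_queryRest hx) h.eval_dirCount, Setup.queryA, dirRes, eval_reg,
      h.D]
    simp only [Int.cast_sub, Int.cast_natCast]
  · rw [eval_sub, eval_rem (h.eval_queryRest₁ hx) h.eval_dirCount, Setup.queryB, dirRes, eval_reg,
      h.D]
    simp only [Int.cast_sub, Int.cast_natCast]
  · rw [eval_sub, eval_rem (h.eval_queryRest₂ hx) (y := 19) (by simp), Setup.queryY]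
    simp only [Int.cast_sub, Int.cast_natCast, Int.cast_ofNat, eval_ofNat, Nat.cast_ofNat]
  · rw [eval_sub, eval_rem (h.eval_queryRest₃ hx) (y := 19) (by simp), Setup.queryZ]
    simp only [Int.cast_sub, Int.cast_natCast, Int.cast_ofNat, eval_ofNat, Nat.cast_ofNat]

end

/-- List pointers hold the arc number plus one, hence the `reg 9 - 1` in the owner of an arc. -/
theorem joinSpec : JoinSpec s A.arcs A.queries A.ok A.kC A.kP A.queryOwner A.arcOwner
    (arcTest (reg 7)) (arcKeyE (reg 7)) (pointKeyE (reg 8)) (queryOwnerE (reg 8))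
    (arcOwnerE (reg 9 - 1)) arcsE queriesE where
  boundE s hA := by
    have h := h.of_agree hA
    simp [arcsE, Setup.arcs, res, h.G, h.n]
  boundF s hA := by
    have h := h.of_agree hA
    simp [queriesE, Setup.queries, h.eval_dirCount, h.m]
  ok s hA e he h7 := (h.of_agree hA).holds_arcTest h7 he
  keyC s hA e he h7 := (h.of_agree hA).eval_arcKeyE h7 he
  keyP s hA f hf h8 := (h.of_agree hA).eval_pointKeyE h8 hf
  ownP s hA f _ h8 := (h.of_agree hA).eval_queryOwnerE h8
  ownC s hA e _ h9 := (h.of_agree hA).eval_arcOwnerE (by simp [h9])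

end Loaded

end RealRAM

/-! ### Multiplicity and number of reports -/

namespace RealRAM

theorem mem_joinList {ok : ℕ → Prop} {kC kP : ℕ → ℤ} {oP oC : ℕ → ℕ} {E F : ℕ} {q : ℕ × ℕ} :
    q ∈ joinList ok kC kP oP oC E F ↔
      ∃ f < F, ∃ e < E, ok e ∧ kC e = kP f ∧ (oP f, oC e) = q := by
  simp only [joinList, List.mem_flatMap, List.mem_range, List.mem_map, mem_bucket, and_assoc]

/-- The multiplicity of a pair in the output of a join is the number of matches that produce it. -/
theorem count_joinList_le {ok : ℕ → Prop} {kC kP : ℕ → ℤ} {oP oC : ℕ → ℕ} {E F M : ℕ} {q : ℕ × ℕ}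
    (φ : ℕ × ℕ → ℕ) (hφ : ∀ x, φ x < M)
    (inj : ∀ f < F, ∀ e < E, ok e → kC e = kP f → (oP f, oC e) = q →
      ∀ f' < F, ∀ e' < E, ok e' → kC e' = kP f' → (oP f', oC e') = q →
        φ (f, e) = φ (f', e') → f = f' ∧ e = e') :
    (joinList ok kC kP oP oC E F).count q ≤ M := by
  classical
  -- Kept as index pairs, the matches are free of repetitions, so the multiplicity of `q` is the
  -- number of matches with these owners, and `φ` is injective on them.
  set l : List (ℕ × ℕ) :=
    (List.range F).flatMap fun f => (bucket ok kC E (kP f)).map fun e => (f, e) with hl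
  have hmem : ∀ x, x ∈ l ↔ x.1 < F ∧ x.2 < E ∧ ok x.2 ∧ kC x.2 = kP x.1 := by
    rintro ⟨f, e⟩
    simp only [hl, List.mem_flatMap, List.mem_range, List.mem_map, mem_bucket, Prod.mk.injEq]
    constructor
    · rintro ⟨f, hf, e, he, rfl, rfl⟩
      exact ⟨hf, he⟩
    · rintro ⟨hf, he⟩
      exact ⟨f, hf, e, he, rfl, rfl⟩
  have hnodup : l.Nodup := by
    rw [hl, List.nodup_flatMap]
    refine ⟨fun f _ => (nodup_bucket ok kC E (kP f)).map fun a b h => (Prod.ext_iff.1 h).2, ?_⟩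
    refine List.nodup_range.imp fun {a b} hab => ?_
    rw [Function.onFun, List.disjoint_left]
    intro x hx hx'
    simp only [List.mem_map] at hx hx'
    obtain ⟨_, -, rfl⟩ := hx
    obtain ⟨_, -, h⟩ := hx'
    exact hab (Prod.ext_iff.1 h).1.symm
  have hmap : joinList ok kC kP oP oC E F = l.map fun x => (oP x.1, oC x.2) := by
    rw [hl, joinList, List.map_flatMap]
    simp [Function.comp_def]
  rw [hmap, List.count, List.countP_map, List.countP_eq_length_filter,
    ← List.toFinset_card_of_nodup (hnodup.filter _)]
  refine (Finset.card_le_card_of_injOn φ (t := Finset.range M) (fun x _ => by simpa using hφ x)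
    ?_).trans_eq (Finset.card_range M)
  rintro ⟨f, e⟩ hx ⟨f', e'⟩ hx' h
  simp only [List.coe_toFinset, List.mem_filter, Set.mem_ofPred_eq, hmem, Function.comp_apply,
    beq_iff_eq] at hx hx'
  obtain ⟨⟨h1, h2, h3, h4⟩, h5⟩ := hx
  obtain ⟨⟨h1', h2', h3', h4'⟩, h5'⟩ := hx'
  obtain ⟨rfl, rfl⟩ := inj f h1 e h2 h3 h4 h5 f' h1' e' h2' h3' h4' h5' h
  rfl

end RealRAM

namespace Setup

open RealRAM

variable (A : Setup)

/-- The pairs that are reported. -/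
noncomputable def reports : List (ℕ × ℕ) :=
  joinList A.ok A.kC A.kP A.queryOwner A.arcOwner A.arcs A.queries

/-- 426 = 3 · 2 · 71: the residue fixes the axis, the sign, and the combined number of circle and
sample modulo 71. For one circle this number differs by at most 70. -/
theorem arc_eq_of_mod_eq {e e' : ℕ} (hC : A.arcOwner e = A.arcOwner e') (h : e % 426 = e' % 426)
    (hs : |(A.arcSample e : ℤ) - A.arcSample e'| ≤ 70) : e = e' := by
  have h1 := Nat.div_add_mod (e / 3 / 2) (2 * A.G + 1)
  have h2 := Nat.div_add_mod (e' / 3 / 2) (2 * A.G + 1)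
  simp only [arcOwner, arcSample] at hC hs
  rw [hC] at h1
  rw [abs_le] at hs
  generalize (2 * A.G + 1) * (e' / 3 / 2 / (2 * A.G + 1)) = x at h1 h2
  generalize e / 3 / 2 % (2 * A.G + 1) = y at h1 hs
  generalize e' / 3 / 2 % (2 * A.G + 1) = y' at h2 hs
  omega

/-- The arc determines the query by `query_inj`, so only the arcs of the circle that match the point
have to be counted, and their residues modulo 426 are distinct. -/
theorem count_reports_le (q : ℕ × ℕ) : A.reports.count q ≤ 426 := by
  refine count_joinList_le (fun x => x.2 % 426) (fun x => Nat.mod_lt _ (by norm_num)) ?_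
  intro f hf e he hok hk hq f' hf' e' he' hok' hk' hq' hm
  obtain ⟨hP, hC⟩ := Prod.ext_iff.1 (hq.trans hq'.symm)
  -- The sign depends on the residue modulo 6 only, and 6 divides 426; equality of signs has to come
  -- first, as samples are compared only within one half of the circle.
  have hs : arcSign e = arcSign e' := by
    have : e / 3 % 2 = e' / 3 % 2 := by
      dsimp only at hm
      omega
    rw [arcSign, arcSign, this]
  obtain rfl := A.arc_eq_of_mod_eq hC hm
    (sample_close he hf hok hk.symm he' hf' hok' hk'.symm hP hC hs)
  exact ⟨query_inj hf hf' hP (hk.symm.trans hk'), rfl⟩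

theorem lt_of_mem_reports {q : ℕ × ℕ} (h : q ∈ A.reports) : q.1 < A.m ∧ q.2 < A.n := by
  obtain ⟨f, hf, e, he, -, -, rfl⟩ := mem_joinList.1 h
  exact ⟨queryOwner_lt hf, arcOwner_lt he⟩

theorem mem_reports {i j : ℕ} (hi : i < A.m) (hj : j < A.n)
    (h : Metric.infDist (A.p i) (A.C j).carrier ≤ A.r / (A.G * A.D)) : (i, j) ∈ A.reports := by
  obtain ⟨e, he, f, hf, hok, hk, rfl, rfl⟩ := exists_match hi hj h
  exact mem_joinList.2 ⟨f, hf, e, he, hok, hk.symm, rfl⟩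

theorem infDist_le_of_mem_reports {i j : ℕ} (h : (i, j) ∈ A.reports) :
    Metric.infDist (A.p i) (A.C j).carrier ≤ 52 * (A.r / (A.G * A.D)) := by
  obtain ⟨f, hf, e, he, hok, hk, hq⟩ := mem_joinList.1 h
  obtain ⟨rfl, rfl⟩ := Prod.ext_iff.1 hq
  exact infDist_le_of_key_eq he hf hok hk.symm

/-- Arcs contribute 6 · 3 = 18 per unit, queries 3 · 7 · 19² · 9 = 68229. -/
theorem arcs_add_queries_le : A.arcs + A.queries ≤ 70000 * (A.n * A.G + A.m * A.D ^ 2) := by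
  have hD := A.D_pos
  have hG : 0 < A.G := hD.trans_le A.D_le
  have h1 : (2 * A.G + 1) * A.n ≤ (3 * A.G) * A.n := Nat.mul_le_mul_right _ (by omega)
  have h2 : (2 * A.D + 1) * (2 * A.D + 1) ≤ (3 * A.D) * (3 * A.D) :=
    Nat.mul_le_mul (by omega) (by omega)
  have h3 := Nat.mul_le_mul_right A.m h2
  have h4 : A.queries = 7581 * ((2 * A.D + 1) * (2 * A.D + 1) * A.m) := by
    rw [queries]
    ring
  rw [h4, arcs]
  nlinarith [Nat.zero_le (A.n * A.G), Nat.zero_le (A.m * A.D ^ 2)]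

end Setup

/-! ### Arithmetic of the time bound -/

theorem List.length_le_mul_card {α : Type*} [DecidableEq α] (l : List α) {M : ℕ}
    (h : ∀ a, l.count a ≤ M) : l.length ≤ M * l.toFinset.card := by
  rw [← List.sum_toFinset_count_eq_length, mul_comm, ← smul_eq_mul]
  exact Finset.sum_le_card_nsmul _ _ _ fun a _ => h a

theorem exists_lift_fin {m n : ℕ} (l : List (ℕ × ℕ)) (h : ∀ q ∈ l, q.1 < m ∧ q.2 < n) :
    ∃ L : List (Fin m × Fin n), L.map (fun q => ((q.1 : ℕ), (q.2 : ℕ))) = l := by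
  induction l with
  | nil => exact ⟨[], rfl⟩
  | cons q l ih =>
    obtain ⟨L, rfl⟩ := ih fun q hq => h q (by simp [hq])
    obtain ⟨h1, h2⟩ := h q (by simp)
    exact ⟨(⟨q.1, h1⟩, ⟨q.2, h2⟩) :: L, rfl⟩

/-- Few circles: the cost of fine sampling, in terms of the resolution `z`. -/
theorem mul_sq_le_rpow {x y z ε : ℝ} (hx : 0 ≤ x) (hy : 0 ≤ y) (hz : 0 ≤ z) (hε : 0 < ε)
    (hxy : x ≤ z * y) (hzε : z ≤ 1 / ε ^ (1 / 2 : ℝ)) :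
    x * z ^ 2 ≤ y ^ (1 / 3 : ℝ) * x ^ (2 / 3 : ℝ) / ε ^ (7 / 6 : ℝ) := by
  have h1 : x = x ^ (1 / 3 : ℝ) * x ^ (2 / 3 : ℝ) := by
    rw [← Real.rpow_add_of_nonneg hx (by norm_num) (by norm_num)]
    norm_num
  have h2 : x ^ (1 / 3 : ℝ) ≤ z ^ (1 / 3 : ℝ) * y ^ (1 / 3 : ℝ) := by
    rw [← Real.mul_rpow hz hy]
    exact Real.rpow_le_rpow hx hxy (by norm_num)
  -- The exponent is 1/3 + 2 = 7/3, which the bound ε^(-1/2) for `z` turns into ε^(-7/6).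
  have h3 : z ^ (1 / 3 : ℝ) * z ^ 2 ≤ 1 / ε ^ (7 / 6 : ℝ) := by
    rw [← Real.rpow_natCast, ← Real.rpow_add_of_nonneg hz (by norm_num) (by norm_num)]
    refine (Real.rpow_le_rpow hz hzε (by norm_num)).trans_eq ?_
    rw [Real.div_rpow zero_le_one (by positivity), Real.one_rpow, ← Real.rpow_mul hε.le]
    norm_num
  calc x * z ^ 2 = x ^ (1 / 3 : ℝ) * x ^ (2 / 3 : ℝ) * z ^ 2 := by rw [← h1]
    _ ≤ z ^ (1 / 3 : ℝ) * y ^ (1 / 3 : ℝ) * x ^ (2 / 3 : ℝ) * z ^ 2 := by gcongr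
    _ = y ^ (1 / 3 : ℝ) * x ^ (2 / 3 : ℝ) * (z ^ (1 / 3 : ℝ) * z ^ 2) := by ring
    _ ≤ y ^ (1 / 3 : ℝ) * x ^ (2 / 3 : ℝ) * (1 / ε ^ (7 / 6 : ℝ)) := by gcongr
    _ = _ := by ring

theorem time_le {c t N a b d W l : ℕ} {X Y : ℝ} (ht : t ≤ c * (N + a + b + 3 + d))
    (hab : a + b ≤ 70000 * W) (hd : d ≤ 426 * l) (hN : (N : ℝ) ≤ X) (hW : (W : ℝ) ≤ 2 * X + Y)
    (hX : 1 ≤ X) (hY : 0 ≤ Y) : (t : ℝ) ≤ c * 150000 * (X + Y + l) := by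
  have h1 : N + a + b + 3 + d ≤ N + 70000 * W + 3 + 426 * l := by omega
  have h2 : (t : ℝ) ≤ c * (N + 70000 * W + 3 + 426 * l) := by
    exact_mod_cast ht.trans (Nat.mul_le_mul_left c h1)
  rw [mul_assoc]
  refine h2.trans (mul_le_mul_of_nonneg_left ?_ (Nat.cast_nonneg c))
  have : (0 : ℝ) ≤ l := Nat.cast_nonneg l
  linarith

/-! ### The program: choice of the resolutions and total cost -/

namespace RealRAM

open _root_.RealRAM.Expr

/-- Register 4 gets the largest `N` with `N² ε ≤ r`. -/
def findRes : Program :=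
  .while (.le ((reg 4 + 1) * (reg 4 + 1) * reg 3) (reg 2)) (.assign 4 (reg 4 + 1))

/-- The resolutions `G` and `D` are chosen, depending on how many circles there are. -/
def chooseRes : Program :=
  .ite (.le (reg 1) (reg 4 * reg 0)) (.seq (.assign 5 (reg 4 * reg 4)) (.assign 6 1))
    (.seq (.assign 5 (reg 4)) (.assign 6 (reg 4)))

def joinProg : Program :=
  .seq (insertLoop (arcTest (reg 7)) (arcKeyE (reg 7)) arcsE)
    (queryLoop (queryOwnerE (reg 8)) (arcOwnerE (reg 9 - 1)) (pointKeyE (reg 8)) queriesE)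

def prog : Program := .seq findRes (.seq chooseRes joinProg)

/-- The cost of a round of any of the loops, up to a constant factor. -/
def roundCost : ℕ :=
  arcsE.cost + (arcTest (reg 7)).cost + 2 * (arcKeyE (reg 7)).cost + queriesE.cost +
    (pointKeyE (reg 8)).cost + (queryOwnerE (reg 8)).cost + (arcOwnerE (reg 9 - 1)).cost + 60

noncomputable def resolution (r ε : ℝ) : ℕ := ⌊√(r / ε)⌋₊

theorem le_resolution {r ε : ℝ} (hr : 0 < r) (hε : 0 < ε) (k : ℕ) :
    k ≤ resolution r ε ↔ (k : ℝ) * k * ε ≤ r := by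
  rw [resolution, Nat.le_floor_iff (Real.sqrt_nonneg _), Real.le_sqrt (Nat.cast_nonneg k)
    (by positivity), le_div_iff₀ hε, pow_two]

/-- The machine has no square roots, so N is found by counting upwards; these O(N) steps fit into
the time bound. -/
theorem runs_findRes {s : State} {r ε : ℝ} (hr : 0 < r) (hε : 0 < ε) (h2 : s.reg 2 = r)
    (h3 : s.reg 3 = ε) (h4 : s.reg 4 = 0) :
    ∃ t, Runs findRes s (s.setReg 4 (resolution r ε)) t ∧ t ≤ 20 * (resolution r ε + 1) := by
  have key : ∀ k : ℕ, (Test.le ((reg 4 + 1) * (reg 4 + 1) * reg 3) (reg 2)).Holds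
      (s.setReg 4 k) ↔ k < resolution r ε := by
    intro k
    rw [← Nat.succ_le_iff, le_resolution hr hε]
    simp [Test.Holds, State.setReg, h2, h3]
  obtain ⟨s', t, hrun, ⟨rfl, ht⟩⟩ := Runs.while_loop
    (b := .le ((reg 4 + 1) * (reg 4 + 1) * reg 3) (reg 2)) (p := .assign 4 (reg 4 + 1))
    (fun k s' t => s' = s.setReg 4 k ∧ t ≤ 20 * k) (resolution r ε)
    (by
      rintro k hk _ t ⟨rfl, ht⟩
      refine ⟨(key k).2 hk, _, _, .assign .., ?_, ?_⟩
      · simp [State.setReg]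
      · change t + (12 + (3 + 1)) ≤ _
        omega)
    (by
      rintro _ t ⟨rfl, -⟩ hb
      exact absurd ((key _).1 hb) (lt_irrefl _))
    0 (Nat.zero_le _) s 0 ⟨by rw [State.setReg, Nat.cast_zero, ← h4, Function.update_eq_self], le_rfl⟩
  refine ⟨_, hrun, ?_⟩
  change t + 12 ≤ _
  omega

/-- The resolutions along the circles and of the directions. -/
noncomputable def resG (m n N : ℕ) : ℕ := if n ≤ N * m then N * N else N

noncomputable def resD (m n N : ℕ) : ℕ := if n ≤ N * m then 1 else N

theorem resG_mul_resD (m n N : ℕ) : resG m n N * resD m n N = N * N := by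
  rw [resG, resD]
  split_ifs <;> simp

theorem resD_pos {m n N : ℕ} (hN : 0 < N) : 0 < resD m n N := by
  rw [resD]
  split_ifs <;> omega

theorem resD_le_resG {m n N : ℕ} (hN : 0 < N) : resD m n N ≤ resG m n N := by
  rw [resG, resD]
  split_ifs
  · exact Nat.mul_pos hN hN
  · exact le_rfl

theorem runs_chooseRes {s : State} {m n N : ℕ} (h0 : s.reg 0 = m) (h1 : s.reg 1 = n)
    (h4 : s.reg 4 = N) :
    ∃ t, Runs chooseRes s ((s.setReg 5 (resG m n N)).setReg 6 (resD m n N)) t ∧ t ≤ 20 := by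
  obtain ⟨s', t, hrun, rfl, ht⟩ : ∃ s' t, Runs chooseRes s s' t ∧
      s' = (s.setReg 5 (resG m n N)).setReg 6 (resD m n N) ∧ t ≤ 20 := by
    by_cases h : n ≤ N * m
    · have hb : (Test.le (reg 1) (reg 4 * reg 0)).Holds s := by
        simp only [Test.Holds, eval_mul, eval_reg, h0, h1, h4]
        exact_mod_cast h
      exact ⟨_, _, .ite_true hb (.seq (.assign ..) (.assign ..)), by simp [resG, resD, h, h4],
        by decide⟩
    · have hb : ¬ (Test.le (reg 1) (reg 4 * reg 0)).Holds s := by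
        simp only [Test.Holds, eval_mul, eval_reg, h0, h1, h4]
        exact_mod_cast h
      exact ⟨_, _, .ite_false hb (.seq (.assign ..) (.assign ..)),
        by simp [resG, resD, h, h4, State.setReg], by decide⟩
  exact ⟨t, hrun, ht⟩

theorem resolution_le {r ε : ℝ} (hr : r ≤ 1 / 2) (hε : 0 < ε) :
    (resolution r ε : ℝ) ≤ 1 / ε ^ (1 / 2 : ℝ) := by
  rw [le_div_iff₀ (by positivity), ← Real.sqrt_eq_rpow]
  have h : (resolution r ε : ℝ) ≤ √(r / ε) := Nat.floor_le (Real.sqrt_nonneg _)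
  refine (mul_le_mul_of_nonneg_right h (Real.sqrt_nonneg _)).trans ?_
  rw [← Real.sqrt_mul' _ hε.le, div_mul_cancel₀ _ hε.ne']
  exact Real.sqrt_le_iff.2 ⟨zero_le_one, by linarith⟩

theorem add_mul_resolution_le (m n : ℕ) {r ε : ℝ} (hr : r ≤ 1 / 2) (hε : 0 < ε) :
    ((m : ℝ) + n) * resolution r ε ≤ ((m : ℝ) + n) / ε ^ (1 / 2 : ℝ) := by
  rw [div_eq_mul_one_div]
  exact mul_le_mul_of_nonneg_left (resolution_le hr hε) (by positivity)

/-- The threshold n = Nm separates two regimes. Below it, fine sampling with a single slope step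
leaves nN² + m, and `mul_sq_le_rpow` bounds the first term. Above it, nN + mN² ≤ 2nN. -/
theorem work_le (m n : ℕ) {r ε : ℝ} (hN : 0 < resolution r ε) (hr : r ≤ 1 / 2) (hε : 0 < ε) :
    ((n * resG m n (resolution r ε) + m * resD m n (resolution r ε) ^ 2 : ℕ) : ℝ) ≤
      2 * (((m : ℝ) + n) / ε ^ (1 / 2 : ℝ)) +
        (m : ℝ) ^ (1 / 3 : ℝ) * (n : ℝ) ^ (2 / 3 : ℝ) / ε ^ (7 / 6 : ℝ) := by
  have hX := add_mul_resolution_le m n hr hε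
  have hNε := resolution_le hr hε
  set N := resolution r ε
  have hN1 : (1 : ℝ) ≤ N := by exact_mod_cast hN
  have hm0 : (0 : ℝ) ≤ m := Nat.cast_nonneg m
  have hn0 : (0 : ℝ) ≤ n := Nat.cast_nonneg n
  have h1 : (m : ℝ) ≤ m * N := le_mul_of_one_le_right hm0 hN1
  have h2 : (0 : ℝ) ≤ n * N := by positivity
  rw [add_mul] at hX
  rw [resG, resD]
  split_ifs with h
  · have := mul_sq_le_rpow hn0 hm0 (by linarith) hε (by exact_mod_cast h) hNε
    rw [pow_two] at this
    push_cast
    linarith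
  · have h' : (N : ℝ) * m ≤ n := by exact_mod_cast (not_le.1 h).le
    have h3 : (m : ℝ) * N ^ 2 ≤ n * N := by
      rw [pow_two, ← mul_assoc, mul_comm (m : ℝ)]
      exact mul_le_mul_of_nonneg_right h' (by linarith)
    have h4 : 0 ≤ (m : ℝ) ^ (1 / 3 : ℝ) * (n : ℝ) ^ (2 / 3 : ℝ) / ε ^ (7 / 6 : ℝ) := by
      positivity
    push_cast
    linarith

theorem cells_natCast {k : ℕ} (v : Fin k → ℝ) {i : ℕ} (h : i < k) : cells v i = v ⟨i, h⟩ := by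
  simp [cells, h]

end RealRAM

/-- A circle that fills up finite families. -/
noncomputable def unitCircle3 : Circle3 where
  center := 0
  normal := EuclideanSpace.single 0 1
  radius := 1
  norm_normal := by simp
  radius_pos := one_pos

open RealRAM in
theorem runs_prog {m n : ℕ} {r ε : ℝ} {p : Fin m → E3} {C : Fin n → Circle3} (hr : r ≤ 1 / 2)
    (hε : 0 < ε) (hεr : ε ≤ r) (hp : ∀ i, p i ∈ Metric.closedBall (0 : E3) 1)
    (hC : ∀ j, (C j).radius = r)
    (hCB : ∀ j, ((C j).carrier ∩ Metric.closedBall (0 : E3) 1).Nonempty) :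
    ∃ (A : Setup) (s : State) (t : ℕ), A.m = m ∧ A.n = n ∧ A.r = r ∧
      A.G = resG m n (resolution r ε) ∧ A.D = resD m n (resolution r ε) ∧
      (∀ i : Fin m, A.p i = p i) ∧ (∀ j : Fin n, A.C j = C j) ∧
      Runs prog (input r ε p C) s t ∧ s.out = A.reports.map castPair ∧
      t ≤ roundCost * (resolution r ε + A.arcs + A.queries + 3 + A.reports.length) := by
  have hr0 : 0 < r := hε.trans_le hεr
  have hN : 0 < resolution r ε := (le_resolution hr0 hε 1).2 (by simpa using hεr)
  set N := resolution r ε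
  let A : Setup :=
    { m := m, n := n, G := resG m n N, D := resD m n N, r := r
      -- The finite families are continued by dummy values; every requirement concerns indices below
      -- `m` and `n` only.
      p := fun i => if h : i < m then p ⟨i, h⟩ else 0
      C := fun j => if h : j < n then C ⟨j, h⟩ else unitCircle3
      D_pos := resD_pos hN
      D_le := resD_le_resG hN
      r_le := hr
      r_pos := hr0
      norm_p := fun i hi => by simpa [hi] using hp ⟨i, hi⟩
      radius := fun j hj => by simpa [hj] using hC ⟨j, hj⟩
      meets := fun j hj => by simpa [hj] using hCB ⟨j, hj⟩ }
  obtain ⟨t₁, hr₁, ht₁⟩ := runs_findRes (s := input r ε p C) hr0 hε rfl rfl rfl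
  obtain ⟨t₂, hr₂, ht₂⟩ := runs_chooseRes (s := (input r ε p C).setReg 4 N) (m := m) (n := n)
    (N := N) (by simp [State.setReg, input]) (by simp [State.setReg, input])
    (by simp [State.setReg])
  set s₂ := (((input r ε p C).setReg 4 N).setReg 5 (resG m n N)).setReg 6 (resD m n N)
  have hL : Loaded A s₂ := by
    refine ⟨?_, ?_, ?_, ?_, ?_, ?_, ?_, ?_⟩
    · simp [s₂, State.setReg, input, A]
    · simp [s₂, State.setReg, input, A]
    · simp [s₂, State.setReg, input, A]
    · simp [s₂, State.setReg, A]
    · simp [s₂, State.setReg, A]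
    · intro i hi k
      have hi' : i < m := hi
      fin_cases k <;> simp [s₂, State.setReg, input, cells_natCast _ hi', A, hi']
    · intro j hj k
      have hj' : j < n := hj
      fin_cases k <;> simp [s₂, State.setReg, input, cells_natCast _ hj', A, hj']
    · intro j hj k
      have hj' : j < n := hj
      fin_cases k <;> simp [s₂, State.setReg, input, cells_natCast _ hj', A, hj']
  obtain ⟨s, t₃, hr₃, hout, ht₃⟩ := hL.joinSpec.runs (by simp [s₂, State.setReg, input])
    (by simp [s₂, State.setReg, input]) (by simp [s₂, State.setReg, input])
  refine ⟨A, s, _, rfl, rfl, rfl, rfl, rfl, fun i => by simp [A], fun j => by simp [A],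
    .seq hr₁ (.seq hr₂ hr₃), hout, ?_⟩
  change t₃ ≤ roundCost * (A.arcs + A.queries + 2 + A.reports.length) at ht₃
  have h60 : 60 ≤ roundCost := Nat.le_add_left _ _
  nlinarith

theorem mainTheorem6 :
    ∃ (prog : RealRAM.Program) (α c₀ K : ℝ) (M : ℕ), 0 < α ∧ 0 < c₀ ∧ 0 < K ∧
      ∀ (m n : ℕ) (r ε : ℝ) (p : Fin m → E3) (C : Fin n → Circle3),
        0 < m + n →
        r ≤ 1 / 2 → 0 < ε → ε ≤ c₀ * r →
        (∀ i, p i ∈ Metric.closedBall (0 : E3) 1) →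
        (∀ j, (C j).radius = r) →
        (∀ j, ((C j).carrier ∩ Metric.closedBall (0 : E3) 1).Nonempty) →
        ∃ (s : RealRAM.State) (t : ℕ) (L : List (Fin m × Fin n)),
          -- the program halts after `t` steps, and `L` lists its reports, with repetitions
          RealRAM.Runs prog (RealRAM.input r ε p C) s t ∧
          s.out = L.map (fun q => (((q.1 : ℕ) : ℝ), ((q.2 : ℕ) : ℝ))) ∧
          (∀ i j, Metric.infDist (p i) (C j).carrier ≤ ε → (i, j) ∈ L) ∧
          (∀ i j, (i, j) ∈ L → Metric.infDist (p i) (C j).carrier ≤ α * ε) ∧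
          (∀ q, L.count q ≤ M) ∧
          (t : ℝ) ≤ K * (((m : ℝ) + n) / ε ^ (1 / 2 : ℝ)
            + (m : ℝ) ^ (1 / 3 : ℝ) * (n : ℝ) ^ (2 / 3 : ℝ) / ε ^ (7 / 6 : ℝ)
            + L.toFinset.card) := by
  -- 208 = 52 · 4, from 52 units r/(GD) of at most 4ε each. The constant 1 for `c₀` suffices, since
  -- ε ≤ r already gives N ≥ 1.
  refine ⟨RealRAM.prog, 208, 1, RealRAM.roundCost * 150000, 426, by norm_num, one_pos, ?_, ?_⟩
  · have : 0 < RealRAM.roundCost := Nat.succ_pos _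
    positivity
  intro m n r ε p C hmn hr hε hεr hp hC hCB
  rw [one_mul] at hεr
  have hr0 : 0 < r := hε.trans_le hεr
  obtain ⟨A, s, t, hm, hn, hAr, hG, hD, hAp, hAC, hrun, hout, ht⟩ :=
    runs_prog hr hε hεr hp hC hCB
  obtain ⟨L, hL⟩ := exists_lift_fin (m := m) (n := n) A.reports fun q hq => by
    rw [← hm, ← hn]
    exact A.lt_of_mem_reports hq
  have hinj : Function.Injective fun q : Fin m × Fin n => ((q.1 : ℕ), (q.2 : ℕ)) := by
    rintro ⟨i, j⟩ ⟨i', j'⟩ h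
    simpa [Fin.ext_iff] using h
  have hmemL : ∀ i j, (i, j) ∈ L ↔ ((i : ℕ), (j : ℕ)) ∈ A.reports := by
    intro i j
    rw [← hL]
    exact (List.mem_map_of_injective hinj (a := (i, j))).symm
  have hcount : ∀ q, L.count q ≤ 426 := fun q => by
    rw [← List.count_map_of_injective L _ hinj q, hL]
    exact A.count_reports_le _
  set N := RealRAM.resolution r ε with hNdef
  have hN : 0 < N := (RealRAM.le_resolution hr0 hε 1).2 (by simpa using hεr)
  have hN' : (0 : ℝ) < N := by exact_mod_cast hN
  have hNle : (N : ℝ) * N * ε ≤ r := (RealRAM.le_resolution hr0 hε N).1 le_rfl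
  have hNlt : r < (N + 1) * (N + 1) * ε := by
    by_contra h
    have := (RealRAM.le_resolution hr0 hε (N + 1)).2 (by push_cast; linarith)
    omega
  have hGD : (A.G : ℝ) * A.D = N * N := by
    rw [hG, hD]
    exact_mod_cast RealRAM.resG_mul_resD m n N
  have hres1 : ε ≤ A.r / (A.G * A.D) := by
    rw [hGD, hAr, le_div_iff₀ (by positivity)]
    linarith
  -- By maximality of N, r < (N + 1)² ε ≤ 4N² ε, using N ≥ 1.
  have hres2 : A.r / (A.G * A.D) ≤ 4 * ε := by
    rw [hGD, hAr, div_le_iff₀ (by positivity)]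
    have : (1 : ℝ) ≤ N := by exact_mod_cast hN
    nlinarith
  refine ⟨s, t, L, hrun, ?_, ?_, ?_, hcount, ?_⟩
  · rw [hout, ← hL, List.map_map]
    rfl
  · intro i j h
    rw [hmemL]
    exact A.mem_reports (hm ▸ i.2) (hn ▸ j.2) (by rw [hAp, hAC]; exact h.trans hres1)
  · intro i j h
    have := A.infDist_le_of_mem_reports ((hmemL i j).1 h)
    rw [hAp, hAC] at this
    linarith
  · have hlen : A.reports.length ≤ 426 * L.toFinset.card := by
      rw [← hL, List.length_map]
      exact L.length_le_mul_card fun q => by convert hcount q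
    have hAQ := A.arcs_add_queries_le
    have hX' := RealRAM.add_mul_resolution_le m n hr hε
    have hN1 : (1 : ℝ) ≤ N := by exact_mod_cast hN
    have hmn' : (1 : ℝ) ≤ (m : ℝ) + n := by exact_mod_cast hmn
    -- The search for N is paid for by the term (m + n)/ε^(1/2), because the input is not empty.
    have hNX : (N : ℝ) ≤ ((m : ℝ) + n) / ε ^ (1 / 2 : ℝ) :=
      (le_mul_of_one_le_left hN'.le hmn').trans hX'
    have hwork := RealRAM.work_le m n hN hr hε
    rw [← hG, ← hD] at hwork
    rw [hm, hn] at hAQ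
    exact time_le ht hAQ hlen hNX hwork (hN1.trans hNX) (by positivity)
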